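/- For $n\ge 0$ let $G_n$ be the level-$n$ Sierpiński gasket graph: $G_0$ is a triangle with corners $u_0,u_1,u_2$, the corners of an equilateral triangle of side $1$ with $u_0=0$, and $G_{n+1}=\bigcup_{i=0}^{2}\bigl(G_n+2^n u_i\bigr)$. Let $V_n$ be its vertex set, so $|V_n|=\tfrac32(3^n+1)$. Impose normal boundary conditions: each of the three corners $2^n u_i$ of $G_n$ is joined by two edges to an additional vertex $s$, the sink, so that every vertex of $V_n$ has degree $4$. For a sandpile $\eta:V_n\to\mathbb{N}$ let $\eta^\circ$ be its stabilization (a vertex with at least $4$ chips topples by sending one chip along each of its edges; chips that reach $s$ are lost), and let $\eta\oplus\sigma=(\eta+\sigma)^\circ$. Let $\mathcal{R}_n$ be the set of recurrent sandpiles, i.e. the stable $\eta$ of the form $\eta=\eta^{\max}\oplus\sigma$ with $\sigma$ stable, where $\eta^{\max}\equiv 3$; $(\mathcal{R}_n,\oplus)$ is a finite abelian group, with identity $\mathsf{id}_n$. The abelian sandpile Markov chain on $\mathcal{R}_n$ moves from $\eta$ to $\eta\oplus\delta_v$, where $v$ is chosen uniformly at random from $V_n\cup\{s\}$, $\delta_v$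 is the sandpile with one chip at $v$ if $v\in V_n$, and $\delta_s=0$. Let $\mathsf{P}_n$ be its transition matrix, $\pi_n$ the uniform distribution on $\mathcal{R}_n$, and $$t_{\mathsf{mix}}(n)=\min\bigl\{t\in\mathbb{N}:\ \|\mathsf{P}_n^t(\mathsf{id}_n,\cdot)-\pi_n\|_{\mathsf{TV}}\le \tfrac14\bigr\}.$$ **Theorem.** For $n\ge 2$ the mixing time of this chain is of order $|V_n|\log|V_n|$, that is, of order $n\cdot 3^n$. More precisely, there are absolute constants $c,C,c_0>0$ such that for every $n\ge 2$ the mixing time $t_{\mathsf{mix}}(n)$ is finite and $$c\,|V_n|\log|V_n|\le t_{\mathsf{mix}}(n)\le C\,|V_n|\log|V_n|,\qquad c\,n3^n\le t_{\mathsf{mix}}(n)\le C\,n3^n,$$ $$t_{\mathsf{mix}}(n)\ge \frac{|V_n|}{12}\log|V_n|-c_0|V_n|.$$ -/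

import Mathlib

/-- A finite undirected loopless multigraph with vertex set `V ∪ {s}`. The sink `s` is `none`, and
`mult x y` is the number of edges between `x` and `y`. -/
structure SinkGraph (V : Type) where
  mult : Option V → Option V → ℕ
  symm : ∀ x y, mult x y = mult y x
  loopless : ∀ x, mult x x = 0

namespace SinkGraph

variable {V : Type} [Fintype V] [DecidableEq V] (G : SinkGraph V)

/-- The degree of a non-sink vertex; edges to the sink are counted. -/
def deg (v : V) : ℕ := ∑ w : Option V, G.mult (some v) w

/-- The reduced graph Laplacian. -/
def laplacian : Matrix V V ℤ :=
  Matrix.of fun v w => if v = w then (G.deg v : ℤ) else -(G.mult (some v) (some w) : ℤ)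

/-- A sandpile is stable if no vertex can topple. -/
def IsStable (η : V → ℕ) : Prop := ∀ v, η v < G.deg v

/-- `η'` arises from `η` by one legal toppling: an unstable vertex `v` is toppled,
`η' = η - Δ δ_v`. -/
def Topples (η η' : V → ℕ) : Prop :=
  ∃ v, G.deg v ≤ η v ∧ ∀ w, (η' w : ℤ) = (η w : ℤ) - G.laplacian w v

/-- `ζ` is stable and is reached from `η` by finitely many legal topplings. -/
def IsStabilization (η ζ : V → ℕ) : Prop :=
  Relation.ReflTransGen G.Topples η ζ ∧ G.IsStable ζ

open Classical in
/-- The stabilization `η°` (with the value `η` in case that no stabilization exists, which does not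
occur when the graph is connected). -/
noncomputable def stabilize (η : V → ℕ) : V → ℕ :=
  if h : ∃ ζ, G.IsStabilization η ζ then h.choose else η

/-- `η ⊕ σ = (η + σ)°`. -/
noncomputable def oplus (η σ : V → ℕ) : V → ℕ := G.stabilize (η + σ)

/-- The maximal stable sandpile. -/
def etaMax : V → ℕ := fun v => G.deg v - 1

/-- A sandpile is recurrent if it is stable and of the form `η^max ⊕ σ` with `σ` stable. -/
def IsRecurrent (η : V → ℕ) : Prop :=
  G.IsStable η ∧ ∃ σ, G.IsStable σ ∧ η = G.oplus G.etaMax σ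

/-- The set of recurrent sandpiles (the underlying set of the sandpile group). -/
def Recurrent : Type := {η : V → ℕ // G.IsRecurrent η}

theorem finite_isRecurrent : {η : V → ℕ | G.IsRecurrent η}.Finite :=
  (Set.Finite.pi' fun v => Set.finite_Iio (G.deg v)).subset fun _ h v => h.1 v

noncomputable instance : Fintype G.Recurrent := G.finite_isRecurrent.fintype

instance : DecidableEq G.Recurrent :=
  inferInstanceAs (DecidableEq {η : V → ℕ // G.IsRecurrent η})

/-- One chip at `x`; a chip at the sink is lost. -/
def chip : Option V → (V → ℕ)
  | some v => Pi.single v 1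
  | none => 0

/-- The transition matrix of the sandpile chain on the recurrent sandpiles: choose `x ∈ V ∪ {s}`
uniformly at random, add a chip at `x` and stabilize. -/
noncomputable def transition : Matrix G.Recurrent G.Recurrent ℝ :=
  Matrix.of fun η ζ =>
    ((Finset.univ.filter fun x : Option V => G.oplus η.1 (chip x) = ζ.1).card : ℝ) /
      (Fintype.card V + 1 : ℝ)

/-- `e` is the identity element of the sandpile group. -/
def IsIdentity (e : G.Recurrent) : Prop := ∀ η : G.Recurrent, G.oplus e.1 η.1 = η.1

/-- Total variation distance of two functions (distributions) on the recurrent sandpiles. -/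
noncomputable def tvDist (μ ν : G.Recurrent → ℝ) : ℝ := (1 / 2) * ∑ η, |μ η - ν η|

/-- The uniform distribution on the recurrent sandpiles. -/
noncomputable def uniform : G.Recurrent → ℝ := fun _ => 1 / (Fintype.card G.Recurrent : ℝ)

/-- `T` is the mixing time `t_mix(ε)`: the least `t` for which the distribution at time `t` of the
chain started at the identity element is within `ε` of uniform in total variation. -/
def IsMixingTime (ε : ℝ) (T : ℕ) : Prop :=
  ∃ e : G.Recurrent, G.IsIdentity e ∧
    IsLeast {t : ℕ | G.tvDist ((G.transition ^ t) e) G.uniform ≤ ε} T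

end SinkGraph

/-- The corners of the unit triangle, in the coordinates of the triangular lattice: `(a, b)` stands
for the point `a • (1, 0) + b • (1/2, √3/2)` of the plane. -/
def gasketCorner : Fin 3 → ℕ × ℕ := ![(0, 0), (1, 0), (0, 1)]

/-- The vertices of the level-`n` Sierpiński gasket graph with edges of length one: level `n + 1` is
the union of the translates of level `n` by `2 ^ n` times the three corners. -/
def gasketVertices : ℕ → Finset (ℕ × ℕ)
  | 0 => Finset.univ.image gasketCorner
  | n + 1 => Finset.univ.biUnion fun i : Fin 3 =>
      (gasketVertices n).image fun x => 2 ^ n • gasketCorner i + x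

/-- The edges of the level-`n` Sierpiński gasket graph, by the same recursion from a triangle. -/
def gasketEdges : ℕ → Finset (Sym2 (ℕ × ℕ))
  | 0 => {s(gasketCorner 0, gasketCorner 1), s(gasketCorner 1, gasketCorner 2),
      s(gasketCorner 0, gasketCorner 2)}
  | n + 1 => Finset.univ.biUnion fun i : Fin 3 =>
      (gasketEdges n).image (Sym2.map fun x => 2 ^ n • gasketCorner i + x)

theorem gasketEdges_not_isDiag (n : ℕ) : ∀ e ∈ gasketEdges n, ¬ e.IsDiag := by
  induction n with
  | zero => decide
  | succ n ih =>
    intro e he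
    simp only [gasketEdges, Finset.mem_biUnion, Finset.mem_image] at he
    obtain ⟨i, -, e', he', rfl⟩ := he
    induction e' with
    | _ x y =>
      have := ih _ he'
      simpa using this

/-- The edge multiplicities of the gasket graph with normal boundary conditions: gasket edges are
simple, and each of the three corners `2 ^ n • gasketCorner i` is joined to the sink by two
edges. -/
def gasketMult (n : ℕ) :
    Option {x // x ∈ gasketVertices n} → Option {x // x ∈ gasketVertices n} → ℕ
  | some x, some y => if s(x.1, y.1) ∈ gasketEdges n then 1 else 0
  | some x, none => if ∃ i, x.1 = 2 ^ n • gasketCorner i then 2 else 0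
  | none, some x => if ∃ i, x.1 = 2 ^ n • gasketCorner i then 2 else 0
  | none, none => 0

/-- The level-`n` Sierpiński gasket graph with normal boundary conditions. -/
def gasketGraph (n : ℕ) : SinkGraph {x // x ∈ gasketVertices n} where
  mult := gasketMult n
  symm := by
    rintro (_ | x) (_ | y)
    · rfl
    · rfl
    · rfl
    · simp only [gasketMult, Sym2.eq_swap]
  loopless := by
    rintro (_ | x)
    · rfl
    · have h : s(x.1, x.1) ∉ gasketEdges n := fun h => gasketEdges_not_isDiag n _ h rfl
      simp [gasketMult, h]

/-! Recurrent sandpiles represent the classes of the sandpile group `ℤ^V / Δℤ^V`, and adding a chip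
is translation by the class of that chip. The chain is therefore a random walk on a finite abelian
group: every character `ψ` is an eigenfunction, with eigenvalue the average of `ψ` over the classes
of the chips, the sink included.

Upper bound (`IsGrounded.tvDist_le`). By Cauchy–Schwarz and Parseval, four times the squared
distance is at most `∑ ‖λ_ψ‖ ^ (2t)` over `ψ ≠ 0`. Write `ψ` at the chip classes as `exp (i (2πg +
θ))` with `|g| ≤ 1/2` and `θ = arg λ_ψ`. Then `‖λ_ψ‖` is an average of cosines, at most `1 -
8/(|V|+1) * ∑ g²`. Since `ψ` respects the toppling relations, `ν = Δg` is an integer vector; it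
determines `ψ`, and `∑ ν² ≤ 4D² ∑ g²` when degrees are at most `D`. So the sum over `ψ` is dominated
by a sum of `q ^ (∑ ν²)` over nonzero integer vectors, hence by `(1+4q)^|V| - 1`, which is small as
soon as `q` is a small multiple of `1/|V|`. This takes time of order `|V| log |V|`.

Lower bound (`IsGrounded.card_mul_pow_le`). In each of the `3^(n-1)` copies of the level-one graph,
the indicator of the three inner vertices is harmonic modulo two: an inner vertex has two neighbours
outside the set, a corner of the copy has two neighbours in it, and sink edges come in pairs. The
resulting sign characters have eigenvalue `1 - 6/(|V|+1)`. Their supports are disjoint, so the sum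
of these characters has small variance both under the chain and under `π`. Its mean under the chain
stands out from `0` until about `(|V|/12) log |V|` steps, by a second moment argument. -/

set_option linter.unusedSectionVars false

/-! ### The Laplacian and the maximum principle. -/

namespace SinkGraph

variable {V : Type} [Fintype V] [DecidableEq V] (G : SinkGraph V)

/-- The Laplacian of the whole graph, at a non-sink vertex, of a function on `V ∪ {s}`. -/
def fullLaplacian {R : Type*} [CommRing R] (f : Option V → R) (v : V) : R :=
  ∑ w, (G.mult (some v) w : R) * (f (some v) - f w)

/-- Every non-sink vertex is connected to the sink, witnessed by a function that can be decreased
along an edge at every non-sink vertex. -/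
def IsGrounded : Prop :=
  ∃ d : Option V → ℕ, ∀ v, ∃ w, G.mult (some v) w ≠ 0 ∧ d w < d (some v)

/-- The extension of a function by `0` at the sink. -/
def extendZero {R : Type*} [Zero R] (u : V → R) : Option V → R := fun x => x.elim 0 u

theorem laplacian_apply (v w : V) :
    G.laplacian v w = if v = w then (G.deg v : ℤ) else -(G.mult (some v) (some w) : ℤ) := rfl

theorem sum_laplacian_mul {R : Type*} [CommRing R] (u : V → R) (v : V) :
    ∑ w, (G.laplacian v w : R) * u w = G.fullLaplacian (extendZero u) v := by
  have h1 : ∀ w, (G.laplacian v w : R) * u w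
      = (if v = w then (G.deg v : R) * u v else 0) - (G.mult (some v) (some w) : R) * u w := by
    intro w
    rw [laplacian_apply]
    split_ifs with h
    · subst h; simp [G.loopless]
    · push_cast; ring
  simp only [h1, Finset.sum_sub_distrib, Finset.sum_ite_eq,
    Finset.mem_univ, if_true, fullLaplacian, mul_sub, ← Finset.sum_mul, deg]
  rw [Fintype.sum_option (fun w => (G.mult (some v) w : R) * extendZero u w)]
  simp [extendZero]

theorem laplacian_mulVec (u : V → ℤ) (v : V) :
    G.laplacian.mulVec u v = G.fullLaplacian (extendZero u) v := by
  rw [← sum_laplacian_mul]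
  rfl

theorem laplacian_symm (v w : V) : G.laplacian v w = G.laplacian w v := by
  simp only [laplacian_apply, G.symm (some v) (some w), eq_comm (a := v)]
  split_ifs with h
  · rw [h]
  · rfl

theorem fullLaplacian_neg {R : Type*} [CommRing R] (f : Option V → R) (v : V) :
    G.fullLaplacian (-f) v = -G.fullLaplacian f v := by
  simp only [fullLaplacian, ← Finset.sum_neg_distrib, Pi.neg_apply]
  exact Finset.sum_congr rfl fun _ _ => by ring

theorem fullLaplacian_sub {R : Type*} [CommRing R] (f g : Option V → R) (v : V) :
    G.fullLaplacian (f - g) v = G.fullLaplacian f v - G.fullLaplacian g v := by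
  simp only [fullLaplacian, ← Finset.sum_sub_distrib, Pi.sub_apply]
  exact Finset.sum_congr rfl fun _ _ => by ring

variable {G}

/-- The maximum principle. -/
theorem IsGrounded.nonpos {R : Type*} [CommRing R] [LinearOrder R] [IsStrictOrderedRing R]
    (hG : G.IsGrounded) {f : Option V → R} (h0 : f none ≤ 0)
    (h : ∀ v, 0 < f (some v) → G.fullLaplacian f v ≤ 0) (x : Option V) : f x ≤ 0 := by
  obtain ⟨d, hd⟩ := hG
  obtain ⟨x0, hx0⟩ := Finite.exists_max f
  obtain ⟨y, hy, hmin⟩ := Finset.exists_min_image (Finset.univ.filter fun x => f x = f x0) d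
    ⟨x0, by simp⟩
  simp only [Finset.mem_filter, Finset.mem_univ, true_and] at hy hmin
  refine (hx0 x).trans ?_
  by_contra! hpos
  rcases y with _ | v
  · rw [← hy] at hpos
    exact absurd hpos h0.not_gt
  · obtain ⟨w, hw, hlt⟩ := hd v
    have hne : f w < f x0 := lt_of_le_of_ne (hx0 w) fun he => (hmin w he).not_gt hlt
    refine (h v (hy ▸ hpos)).not_gt ?_
    refine Finset.sum_pos' (fun z _ => ?_) ⟨w, Finset.mem_univ _, ?_⟩
    · exact mul_nonneg (Nat.cast_nonneg _) (by rw [hy]; exact sub_nonneg.2 (hx0 z))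
    · exact mul_pos (by exact_mod_cast Nat.pos_of_ne_zero hw) (by rw [hy]; exact sub_pos.2 hne)

theorem IsGrounded.eq_zero {R : Type*} [CommRing R] [LinearOrder R] [IsStrictOrderedRing R]
    (hG : G.IsGrounded) {f : Option V → R} (h0 : f none = 0)
    (h : ∀ v, G.fullLaplacian f v = 0) (x : Option V) : f x = 0 := by
  refine le_antisymm (hG.nonpos h0.le (fun v _ => (h v).le) x) ?_
  have := hG.nonpos (f := -f) (by simp [h0]) (fun v _ => by rw [fullLaplacian_neg, h v, neg_zero]) x
  simpa using this

theorem IsGrounded.det_ne_zero (hG : G.IsGrounded) : G.laplacian.det ≠ 0 := by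
  intro h
  obtain ⟨u, hu, h⟩ := Matrix.exists_mulVec_eq_zero_iff.2 h
  refine hu (funext fun v => ?_)
  exact hG.eq_zero (f := extendZero u) rfl
    (fun v => by rw [← laplacian_mulVec, h]; rfl) (some v)

theorem IsGrounded.nonneg_of_laplacian_nonneg (hG : G.IsGrounded) {u : V → ℤ}
    (h : ∀ v, u v < 0 → 0 ≤ G.laplacian.mulVec u v) : 0 ≤ u := by
  intro v
  have := hG.nonpos (f := -extendZero u) (by simp [extendZero]) (fun v hv => by
    rw [fullLaplacian_neg, ← laplacian_mulVec]
    have := h v (by simpa [extendZero] using hv)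
    linarith) (some v)
  simpa [extendZero] using this

/-- A nonnegative strictly superharmonic weight. -/
theorem IsGrounded.exists_weight (hG : G.IsGrounded) :
    ∃ W : V → ℤ, 0 ≤ W ∧ ∀ v, 1 ≤ G.laplacian.mulVec W v := by
  have key : ∀ v, G.laplacian.mulVec
      (G.laplacian.det.sign • G.laplacian.adjugate.mulVec 1) v = |G.laplacian.det| := by
    intro v
    rw [Matrix.mulVec_smul, Matrix.mulVec_mulVec, Matrix.mul_adjugate, Matrix.smul_mulVec,
      Matrix.one_mulVec]
    simp
  have h1 : (1 : ℤ) ≤ |G.laplacian.det| := Int.one_le_abs hG.det_ne_zero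
  exact ⟨_, hG.nonneg_of_laplacian_nonneg fun v _ => by rw [key]; exact abs_nonneg _,
    fun v => by rw [key]; exact h1⟩

/-! ### Topplings, the odometer and uniqueness of stabilizations. -/

theorem Topples.add {η η' : V → ℕ} (h : G.Topples η η') (σ : V → ℕ) :
    G.Topples (η + σ) (η' + σ) := by
  obtain ⟨v, hv, h⟩ := h
  refine ⟨v, hv.trans (by simp), fun w => ?_⟩
  have := h w
  simp only [Pi.add_apply, Nat.cast_add]
  linarith

theorem reflTransGen_topples_add {η η' : V → ℕ} (h : Relation.ReflTransGen G.Topples η η')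
    (σ : V → ℕ) : Relation.ReflTransGen G.Topples (η + σ) (η' + σ) :=
  h.lift (· + σ) fun _ _ h => h.add σ

theorem laplacian_mulVec_single (v w : V) :
    G.laplacian.mulVec (Pi.single v 1) w = G.laplacian w v := by
  simp

/-- Toppling `v` lowers the weighted mass `∑ W η` by `(ΔW)(v) ≥ 1`, by symmetry of the Laplacian, so
the mass bounds the number of topplings. -/
theorem IsGrounded.exists_isStabilization (hG : G.IsGrounded) (η : V → ℕ) :
    ∃ ζ, G.IsStabilization η ζ := by
  obtain ⟨W, hW, hW1⟩ := hG.exists_weight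
  suffices ∀ N : ℕ, ∀ η : V → ℕ, ∑ v, W v * (η v : ℤ) ≤ N → ∃ ζ, G.IsStabilization η ζ from
    this (∑ v, W v * (η v : ℤ)).toNat η (Int.self_le_toNat _)
  intro N
  induction N with
  | zero =>
    intro η h
    refine ⟨η, .refl, fun v => ?_⟩
    by_contra! hv
    -- At a zero of the nonnegative `W` one would have `ΔW ≤ 0`. So `W` is positive at `v`, and mass
    -- zero leaves no chips there.
    have hW0 : W v ≠ 0 := by
      intro h0
      have h1 := hW1 v
      rw [laplacian_mulVec] at h1
      have h2 : G.fullLaplacian (extendZero W) v ≤ 0 := by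
        refine Finset.sum_nonpos fun w _ => mul_nonpos_of_nonneg_of_nonpos (by positivity) ?_
        rcases w with _ | w
        · simp [extendZero, h0]
        · simpa [extendZero, h0] using hW w
      linarith
    have hd : 0 < G.deg v := by
      by_contra! hd
      have hd : G.deg v = 0 := by omega
      have h1 := hW1 v
      rw [laplacian_mulVec] at h1
      have h2 : G.fullLaplacian (extendZero W) v = 0 := by
        refine Finset.sum_eq_zero fun w hw => ?_
        rw [Finset.sum_eq_zero_iff.1 hd w hw]
        simp
      linarith
    have h3 : 0 < W v * (η v : ℤ) :=
      mul_pos (lt_of_le_of_ne (hW v) (Ne.symm hW0)) (by exact_mod_cast hd.trans_le hv)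
    have h4 : W v * (η v : ℤ) ≤ ∑ v, W v * (η v : ℤ) :=
      Finset.single_le_sum (f := fun v => W v * (η v : ℤ))
        (fun w _ => mul_nonneg (hW w) (by positivity)) (Finset.mem_univ v)
    push_cast at h
    linarith
  | succ N ih =>
    intro η h
    by_cases hs : G.IsStable η
    · exact ⟨η, .refl, hs⟩
    · simp only [IsStable, not_forall, not_lt] at hs
      obtain ⟨v, hv⟩ := hs
      have hnn : ∀ w, 0 ≤ (η w : ℤ) - G.laplacian w v := by
        intro w
        rw [laplacian_apply]
        split_ifs with hwv
        · subst hwv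
          have : (G.deg w : ℤ) ≤ η w := by exact_mod_cast hv
          linarith
        · rw [sub_neg_eq_add]
          positivity
      have ht : G.Topples η fun w => ((η w : ℤ) - G.laplacian w v).toNat :=
        ⟨v, hv, fun w => Int.toNat_of_nonneg (hnn w)⟩
      obtain ⟨ζ, h1, h2⟩ := ih (fun w => ((η w : ℤ) - G.laplacian w v).toNat) (by
        simp only [Int.toNat_of_nonneg (hnn _), mul_sub, Finset.sum_sub_distrib]
        have h5 : ∑ x, W x * G.laplacian x v = G.laplacian.mulVec W v :=
          Finset.sum_congr rfl fun x _ => by rw [mul_comm, laplacian_symm]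
        have := hW1 v
        push_cast at h
        linarith)
      exact ⟨ζ, .head ht h1, h2⟩

/-- The least action principle. -/
theorem exists_odometer {η ζ : V → ℕ} (h : Relation.ReflTransGen G.Topples η ζ) :
    ∃ u : V → ℤ, 0 ≤ u ∧ (∀ v, (ζ v : ℤ) = η v - G.laplacian.mulVec u v) ∧
      ∀ u' : V → ℤ, 0 ≤ u' → (∀ v, (η v : ℤ) - G.laplacian.mulVec u' v < G.deg v) → u ≤ u' := by
  induction h using Relation.ReflTransGen.head_induction_on with
  | refl => exact ⟨0, le_rfl, by simp, fun u' h _ => h⟩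
  | @head η ξ h _ ih =>
    obtain ⟨v, hv, hξ⟩ := h
    obtain ⟨u, hu, h1, h2⟩ := ih
    have hs : (0 : V → ℤ) ≤ Pi.single v 1 := Pi.single_nonneg.2 zero_le_one
    refine ⟨u + Pi.single v 1, add_nonneg hu hs, fun w => ?_, fun u' hu' hst => ?_⟩
    · rw [h1, hξ, Matrix.mulVec_add, Pi.add_apply, laplacian_mulVec_single]
      ring
    -- If `u'` vanished at `v`, then subtracting `Δu'` could only add chips there, and the unstable
    -- `v` would stay unstable.
    · have hpos : 1 ≤ u' v := by
        by_contra! hlt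
        have h0 : u' v = 0 := le_antisymm (by omega) (hu' v)
        have h3 := hst v
        rw [laplacian_mulVec] at h3
        have h4 : G.fullLaplacian (extendZero u') v ≤ 0 := by
          refine Finset.sum_nonpos fun w _ => mul_nonpos_of_nonneg_of_nonpos (by positivity) ?_
          rcases w with _ | w
          · simp [extendZero, h0]
          · simpa [extendZero, h0] using hu' w
        have : (G.deg v : ℤ) ≤ η v := by exact_mod_cast hv
        linarith
      rw [← le_sub_iff_add_le]
      refine h2 _ ?_ fun w => ?_
      · intro w
        by_cases hw : w = v
        · subst hw; simpa using hpos
        · simpa [hw] using hu' w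
      · rw [hξ, Matrix.mulVec_sub, Pi.sub_apply, laplacian_mulVec_single]
        have := hst w
        linarith

theorem IsStabilization.unique {η ζ ζ' : V → ℕ} (h : G.IsStabilization η ζ)
    (h' : G.IsStabilization η ζ') : ζ = ζ' := by
  obtain ⟨u, hu, h1, h2⟩ := exists_odometer h.1
  obtain ⟨u', hu', h1', h2'⟩ := exists_odometer h'.1
  have e : u = u' := le_antisymm
    (h2 u' hu' fun v => by rw [← h1']; exact_mod_cast h'.2 v)
    (h2' u hu fun v => by rw [← h1]; exact_mod_cast h.2 v)
  subst e
  funext v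
  exact_mod_cast (h1 v).trans (h1' v).symm

theorem IsStabilization.stabilize_eq {η ζ : V → ℕ} (h : G.IsStabilization η ζ) :
    G.stabilize η = ζ := by
  have hex : ∃ ζ, G.IsStabilization η ζ := ⟨ζ, h⟩
  rw [stabilize, dif_pos hex]
  exact hex.choose_spec.unique h

theorem IsGrounded.isStabilization_stabilize (hG : G.IsGrounded) (η : V → ℕ) :
    G.IsStabilization η (G.stabilize η) := by
  obtain ⟨ζ, h⟩ := hG.exists_isStabilization η
  rwa [h.stabilize_eq]

theorem IsGrounded.stabilize_eq_of_reach (hG : G.IsGrounded) {η ζ : V → ℕ}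
    (h : Relation.ReflTransGen G.Topples η ζ) : G.stabilize η = G.stabilize ζ :=
  have hζ := hG.isStabilization_stabilize ζ
  IsStabilization.stabilize_eq ⟨h.trans hζ.1, hζ.2⟩

/-! ### Recurrent sandpiles as representatives of the sandpile group. -/

theorem IsGrounded.deg_pos (hG : G.IsGrounded) (v : V) : 0 < G.deg v := by
  obtain ⟨d, hd⟩ := hG
  obtain ⟨w, hw, -⟩ := hd v
  exact Finset.sum_pos' (fun _ _ => Nat.zero_le _) ⟨w, Finset.mem_univ _, Nat.pos_of_ne_zero hw⟩

theorem IsGrounded.isRecurrent_stabilize (hG : G.IsGrounded) {η : V → ℕ} (h : G.etaMax ≤ η) :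
    G.IsRecurrent (G.stabilize η) := by
  have hσ := hG.isStabilization_stabilize (η - G.etaMax)
  refine ⟨(hG.isStabilization_stabilize η).2, _, hσ.2, ?_⟩
  have := reflTransGen_topples_add hσ.1 G.etaMax
  rw [tsub_add_cancel_of_le h, add_comm] at this
  exact hG.stabilize_eq_of_reach this

theorem IsGrounded.isRecurrent_oplus (hG : G.IsGrounded) {η : V → ℕ} (h : G.IsRecurrent η)
    (σ : V → ℕ) : G.IsRecurrent (G.oplus η σ) := by
  obtain ⟨-, τ, -, rfl⟩ := h
  have h1 := hG.isStabilization_stabilize (G.etaMax + τ)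
  have := hG.stabilize_eq_of_reach (reflTransGen_topples_add h1.1 σ)
  rw [oplus, oplus, ← this]
  exact hG.isRecurrent_stabilize fun v => by simp only [Pi.add_apply]; omega

variable (G) in
/-- The lattice spanned by the columns of the Laplacian. -/
def toppleLattice : AddSubgroup (V → ℤ) := G.laplacian.mulVecLin.toAddMonoidHom.range

variable (G) in
/-- The sandpile group, as a quotient of `ℤ^V`. -/
abbrev SandpileGroup : Type := (V → ℤ) ⧸ G.toppleLattice

variable (G) in
/-- The class of a sandpile in the sandpile group. -/
def cls (η : V → ℕ) : G.SandpileGroup := QuotientAddGroup.mk fun v => (η v : ℤ)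

theorem cls_add (η σ : V → ℕ) : G.cls (η + σ) = G.cls η + G.cls σ := by
  rw [cls, cls, cls, ← QuotientAddGroup.mk_add]
  congr 1

theorem cls_eq_of_reach {η ζ : V → ℕ} (h : Relation.ReflTransGen G.Topples η ζ) :
    G.cls η = G.cls ζ := by
  obtain ⟨u, -, h, -⟩ := exists_odometer h
  refine QuotientAddGroup.eq.2 ⟨-u, ?_⟩
  ext v
  simp only [LinearMap.toAddMonoidHom_coe, Matrix.mulVecLin_apply, Matrix.mulVec_neg, Pi.neg_apply,
    Pi.add_apply, h v]
  ring

theorem IsGrounded.cls_oplus (hG : G.IsGrounded) (η σ : V → ℕ) :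
    G.cls (G.oplus η σ) = G.cls η + G.cls σ := by
  rw [← cls_add]
  exact (cls_eq_of_reach (hG.isStabilization_stabilize (η + σ)).1).symm

/-- A recurrent sandpile admits no nontrivial reverse toppling that ends stable. If `w` is the
odometer of `η^max + σ`, then `w - u` also stabilizes it. It is nonnegative because stabilizing
something above `deg - 1` forces `Δ(w - u) ≥ 0`; least action then gives `w ≤ w - u`. -/
theorem IsGrounded.recurrent_add_laplacian (hG : G.IsGrounded) {η : V → ℕ} (h : G.IsRecurrent η)
    {u : V → ℤ} (hu : 0 ≤ u) (hst : ∀ v, (η v : ℤ) + G.laplacian.mulVec u v < G.deg v) : u = 0 := by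
  obtain ⟨-, σ, -, rfl⟩ := h
  obtain ⟨w, hw, h1, h2⟩ := exists_odometer (hG.isStabilization_stabilize (G.etaMax + σ)).1
  have key : ∀ v, ((G.etaMax + σ) v : ℤ) - G.laplacian.mulVec (w - u) v < G.deg v := fun v => by
    have := hst v
    rw [oplus, h1] at this
    rw [Matrix.mulVec_sub, Pi.sub_apply]
    linarith
  have h3 := h2 (w - u) (hG.nonneg_of_laplacian_nonneg fun v _ => by
    have h3 := key v
    have h4 := hG.deg_pos v
    simp only [Pi.add_apply, etaMax, Nat.cast_add, Nat.cast_sub h4] at h3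
    push_cast at h3
    linarith) key
  refine le_antisymm (fun v => ?_) hu
  have := h3 v
  simp only [Pi.sub_apply, Pi.zero_apply] at *
  linarith

theorem laplacian_posPart_le {u : V → ℤ} {v : V} (hv : 0 ≤ u v) :
    G.laplacian.mulVec (u ⊔ 0) v ≤ G.laplacian.mulVec u v := by
  rw [laplacian_mulVec, laplacian_mulVec]
  refine Finset.sum_le_sum fun w _ => mul_le_mul_of_nonneg_left ?_ (by positivity)
  rcases w with _ | w
  · simp [extendZero, hv]
  · simp only [extendZero, Option.elim_some, Pi.sup_apply, Pi.zero_apply, sup_of_le_left hv]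
    have := le_max_left (u w) 0
    linarith

/-- The positive part of `u` is again a reverse toppling with stable outcome: truncation does not
increase `Δu` where `u ≥ 0`, and elsewhere the truncated Laplacian is nonpositive. Applied in both
directions this makes recurrent representatives unique. -/
theorem IsGrounded.recurrent_sub (hG : G.IsGrounded) {η ζ : V → ℕ} (h : G.IsRecurrent η)
    (hζ : G.IsStable ζ) {u : V → ℤ} (hu : ∀ v, (ζ v : ℤ) = η v + G.laplacian.mulVec u v) :
    u ≤ 0 := by
  have h0 : u ⊔ 0 = 0 := by
    refine hG.recurrent_add_laplacian h le_sup_right fun v => ?_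
    rcases le_total 0 (u v) with hv | hv
    · have h1 := laplacian_posPart_le (G := G) hv
      have h2 := hu v
      have h3 : (ζ v : ℤ) < G.deg v := by exact_mod_cast hζ v
      linarith
    · have h1 : G.laplacian.mulVec (u ⊔ 0) v ≤ 0 := by
        rw [laplacian_mulVec]
        refine Finset.sum_nonpos fun w _ => mul_nonpos_of_nonneg_of_nonpos (by positivity) ?_
        rcases w with _ | w <;> simp [extendZero, hv]
      have h3 : (η v : ℤ) < G.deg v := by exact_mod_cast h.1 v
      linarith
  exact sup_eq_right.1 h0

theorem IsGrounded.cls_injOn (hG : G.IsGrounded) {η ζ : V → ℕ} (hη : G.IsRecurrent η)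
    (hζ : G.IsRecurrent ζ) (h : G.cls η = G.cls ζ) : η = ζ := by
  obtain ⟨u, hu⟩ := QuotientAddGroup.eq.1 h
  have hu' : ∀ v, (ζ v : ℤ) = η v + G.laplacian.mulVec u v := fun v => by
    have := congrFun hu v
    simp only [LinearMap.toAddMonoidHom_coe, Matrix.mulVecLin_apply, Pi.add_apply,
      Pi.neg_apply] at this
    linarith
  have h1 := hG.recurrent_sub hη hζ.1 hu'
  have h2 := hG.recurrent_sub hζ hη.1 (u := -u) fun v => by
    rw [Matrix.mulVec_neg, Pi.neg_apply, hu' v]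
    ring
  have h3 : u = 0 := le_antisymm h1 (by simpa using h2)
  funext v
  have := hu' v
  simp only [h3, Matrix.mulVec_zero, Pi.zero_apply, add_zero] at this
  exact_mod_cast this.symm

theorem IsGrounded.exists_recurrent (hG : G.IsGrounded) (k : G.SandpileGroup) :
    ∃ η, G.IsRecurrent η ∧ G.cls η = k := by
  obtain ⟨z, rfl⟩ := QuotientAddGroup.mk_surjective k
  obtain ⟨W, -, hW⟩ := hG.exists_weight
  have hB : ∀ v, (G.deg v : ℤ) - z v ≤ ∑ w, |(G.deg w : ℤ) - z w| := fun v =>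
    (le_abs_self _).trans
      (Finset.single_le_sum (f := fun w => |(G.deg w : ℤ) - z w|) (fun _ _ => abs_nonneg _)
        (Finset.mem_univ v))
  set B := ∑ w, |(G.deg w : ℤ) - z w|
  have hB0 : 0 ≤ B := Finset.sum_nonneg fun _ _ => abs_nonneg _
  have hge : ∀ v, (G.deg v : ℤ) ≤ z v + B * G.laplacian.mulVec W v := fun v => by
    have := mul_le_mul_of_nonneg_left (hW v) hB0
    have := hB v
    linarith
  have hnn : ∀ v, 0 ≤ z v + B * G.laplacian.mulVec W v := fun v =>
    le_trans (by positivity) (hge v)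
  -- Adding `B` times the strictly positive vector `ΔW` keeps the class and lifts `z` above `η^max`,
  -- so the stabilization is recurrent.
  refine ⟨G.stabilize fun v => (z v + B * G.laplacian.mulVec W v).toNat,
    hG.isRecurrent_stabilize fun v => ?_, ?_⟩
  · have := hge v
    simp only [etaMax]
    omega
  · rw [← cls_eq_of_reach (hG.isStabilization_stabilize _).1]
    refine QuotientAddGroup.eq.2 ⟨-(B • W), ?_⟩
    ext v
    simp only [LinearMap.toAddMonoidHom_coe, Matrix.mulVecLin_apply, Matrix.mulVec_neg,
      Matrix.mulVec_smul, Pi.neg_apply, Pi.add_apply, Int.toNat_of_nonneg (hnn v), Pi.smul_apply,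
      smul_eq_mul]
    ring

/-- Recurrent sandpiles represent the elements of the sandpile group. -/
noncomputable def IsGrounded.recurrentEquiv (hG : G.IsGrounded) :
    G.Recurrent ≃ G.SandpileGroup :=
  Equiv.ofBijective (fun η => G.cls η.1)
    ⟨fun η ζ h => Subtype.ext (hG.cls_injOn η.2 ζ.2 h), fun k =>
      let ⟨η, hη, h⟩ := hG.exists_recurrent k
      ⟨⟨η, hη⟩, h⟩⟩

theorem IsGrounded.recurrentEquiv_apply (hG : G.IsGrounded) (η : G.Recurrent) :
    hG.recurrentEquiv η = G.cls η.1 := rfl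

theorem IsGrounded.exists_isIdentity (hG : G.IsGrounded) :
    ∃ e : G.Recurrent, G.IsIdentity e ∧ G.cls e.1 = 0 := by
  obtain ⟨e, he, h⟩ := hG.exists_recurrent 0
  exact ⟨⟨e, he⟩, fun η => hG.cls_injOn (hG.isRecurrent_oplus he _) η.2
    (by rw [hG.cls_oplus, h, zero_add]), h⟩

end SinkGraph

/-! ### Parseval and Gaussian-type sums over integer vectors. -/

/-- Parseval's identity on a finite abelian group. -/
theorem sum_norm_sq_sum_mul_addChar {K : Type*} [AddCommGroup K] [Fintype K] (f : K → ℝ) :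
    ∑ ψ : AddChar K ℂ, ‖∑ k, (f k : ℂ) * ψ k‖ ^ 2 = Fintype.card K * ∑ k, f k ^ 2 := by
  classical
  have h1 : ∀ ψ : AddChar K ℂ, ((‖∑ k, (f k : ℂ) * ψ k‖ ^ 2 : ℝ) : ℂ)
      = ∑ k, ∑ l, (f k : ℂ) * f l * ψ (k - l) := by
    intro ψ
    rw [Complex.ofReal_pow, ← Complex.mul_conj', map_sum, Finset.sum_mul_sum]
    refine Finset.sum_congr rfl fun k _ => Finset.sum_congr rfl fun l _ => ?_
    rw [map_mul, Complex.conj_ofReal, ← AddChar.map_neg_eq_conj, sub_eq_add_neg,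
      AddChar.map_add_eq_mul]
    ring
  rw [← Complex.ofReal_inj, Complex.ofReal_sum, Finset.sum_congr rfl fun ψ _ => h1 ψ,
    Finset.sum_comm]
  have h2 : ∀ k, ∑ ψ : AddChar K ℂ, ∑ l, (f k : ℂ) * f l * ψ (k - l)
      = Fintype.card K * (f k : ℂ) ^ 2 := by
    intro k
    rw [Finset.sum_comm]
    simp_rw [← Finset.mul_sum, AddChar.sum_apply_eq_ite, sub_eq_zero]
    simp only [mul_ite, mul_zero, Finset.sum_ite_eq, Finset.mem_univ, if_true]
    ring
  rw [Finset.sum_congr rfl fun k _ => h2 k, ← Finset.mul_sum]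
  push_cast
  rfl

/-- The term `(1/2)^B` makes the induction close: the two new summands contribute at most `2q
(1/2)^B`, which is exactly the growth of the right side. -/
theorem sum_box_pow_le {q : ℝ} (h0 : 0 ≤ q) (h1 : q ≤ 1 / 2) (B : ℕ) :
    ∑ k ∈ Finset.Icc (-B : ℤ) B, q ^ (k.natAbs ^ 2) ≤ 1 + 4 * q * (1 - (1 / 2) ^ B) := by
  induction B with
  | zero => simp
  | succ B ih =>
    have he : Finset.Icc (-((B + 1 : ℕ) : ℤ)) ((B + 1 : ℕ) : ℤ)
        = insert ((B + 1 : ℕ) : ℤ) (insert (-((B + 1 : ℕ) : ℤ)) (Finset.Icc (-B : ℤ) B)) := by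
      ext k
      simp only [Finset.mem_insert, Finset.mem_Icc]
      omega
    rw [he, Finset.sum_insert, Finset.sum_insert, Int.natAbs_neg, Int.natAbs_natCast]
    · have h2 : q ^ ((B + 1) ^ 2) ≤ q * (1 / 2) ^ B := by
        calc q ^ ((B + 1) ^ 2) ≤ q ^ (B + 1) :=
              pow_le_pow_of_le_one h0 (h1.trans (by norm_num)) (by nlinarith)
          _ = q * q ^ B := by ring
          _ ≤ q * (1 / 2) ^ B := by gcongr
      have h3 : ((1 : ℝ) / 2) ^ (B + 1) = (1 / 2) ^ B / 2 := by ring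
      rw [h3]
      linarith
    · simp only [Finset.mem_Icc]; omega
    · simp only [Finset.mem_insert, Finset.mem_Icc]; omega

theorem sum_prod_pow_sq_le {V : Type*} [Fintype V] [DecidableEq V] {q : ℝ} (h0 : 0 ≤ q)
    (h1 : q ≤ 1 / 2) (S : Finset (V → ℤ)) (hS : 0 ∉ S) :
    ∑ ν ∈ S, q ^ (∑ v, (ν v).natAbs ^ 2) ≤ (1 + 4 * q) ^ Fintype.card V - 1 := by
  obtain ⟨B, hB⟩ : ∃ B : ℕ, ∀ ν ∈ S, ∀ v, (ν v).natAbs ≤ B := by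
    refine ⟨∑ ν ∈ S, ∑ v, (ν v).natAbs, fun ν hν v => ?_⟩
    exact (Finset.single_le_sum (f := fun v => (ν v).natAbs) (fun _ _ => Nat.zero_le _)
      (Finset.mem_univ v)).trans (Finset.single_le_sum (f := fun ν : V → ℤ => ∑ v, (ν v).natAbs)
      (fun _ _ => Nat.zero_le _) hν)
  have hsub : insert 0 S ⊆ Fintype.piFinset fun _ : V => Finset.Icc (-B : ℤ) B := by
    intro ν hν
    rw [Fintype.mem_piFinset]
    intro v
    rw [Finset.mem_Icc]
    rcases Finset.mem_insert.1 hν with rfl | hν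
    · simp
    · have := hB ν hν v
      omega
  have h2 := Finset.sum_le_sum_of_subset_of_nonneg hsub
    (f := fun ν : V → ℤ => q ^ (∑ v, (ν v).natAbs ^ 2)) fun _ _ _ => by positivity
  rw [Finset.sum_insert hS] at h2
  have h3 : ∑ ν ∈ Fintype.piFinset fun _ : V => Finset.Icc (-B : ℤ) B,
      q ^ (∑ v, (ν v).natAbs ^ 2) ≤ (1 + 4 * q) ^ Fintype.card V := by
    simp_rw [← Finset.prod_pow_eq_pow_sum]
    rw [← Finset.prod_univ_sum (fun _ : V => Finset.Icc (-B : ℤ) B)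
      (fun _ k => q ^ (k.natAbs ^ 2))]
    rw [Finset.prod_const, Finset.card_univ]
    refine pow_le_pow_left₀ (Finset.sum_nonneg fun _ _ => by positivity) ?_ _
    refine (sum_box_pow_le h0 h1 B).trans ?_
    have : 0 ≤ 4 * q * (1 / 2) ^ B := by positivity
    linarith
  simp only [Pi.zero_apply, Int.natAbs_zero, ne_eq, OfNat.ofNat_ne_zero, not_false_eq_true,
    zero_pow, Finset.sum_const_zero, pow_zero] at h2
  linarith

/-! ### Characters of the sandpile group as eigenfunctions of the chain. -/

namespace SinkGraph

variable {V : Type} [Fintype V] [DecidableEq V] {G : SinkGraph V}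

theorem cls_chip_none : G.cls (chip none) = 0 :=
  QuotientAddGroup.eq.2 ⟨0, by ext; simp [chip]⟩

variable (G) in
theorem laplacian_apply_eq_sub (v u : V) : G.laplacian u v
    = G.deg v * (chip (some v) u : ℤ) - ∑ w, (G.mult (some v) w : ℤ) * (chip w u : ℤ) := by
  rw [Fintype.sum_option, G.laplacian_symm, laplacian_apply]
  simp only [chip, Pi.zero_apply, Nat.cast_zero, mul_zero, zero_add, Pi.single_apply]
  split_ifs with h h' h'
  · subst h; simp [G.loopless]
  · exact absurd h.symm h'
  · exact absurd h'.symm h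
  · simp

variable (G) in
-- Toppling `v` does not change the class. This relation makes the angles of a character harmonic
-- modulo integers.
theorem sum_mult_smul_cls_sub (v : V) :
    ∑ w, G.mult (some v) w • (G.cls (chip (some v)) - G.cls (chip w)) = 0 := by
  have : ∑ w, G.mult (some v) w • (G.cls (chip (some v)) - G.cls (chip w))
      = QuotientAddGroup.mk (s := G.toppleLattice)
        (∑ w, G.mult (some v) w •
          ((fun u => (chip (some v) u : ℤ)) - fun u => (chip w u : ℤ))) := by
    rw [← QuotientAddGroup.mk'_apply, map_sum]
    rfl
  rw [this]
  refine (QuotientAddGroup.eq_zero_iff _).2 ⟨Pi.single v 1, ?_⟩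
  ext u
  rw [LinearMap.toAddMonoidHom_coe, Matrix.mulVecLin_apply, laplacian_mulVec_single,
    laplacian_apply_eq_sub]
  rw [Finset.sum_apply, deg, Nat.cast_sum, Finset.sum_mul, ← Finset.sum_sub_distrib]
  refine Finset.sum_congr rfl fun w _ => ?_
  rw [Pi.smul_apply, Pi.sub_apply, nsmul_eq_mul, mul_sub]

theorem closure_cls_chip (k : G.SandpileGroup) :
    k ∈ AddSubgroup.closure (Set.range fun v : V => G.cls (chip (some v))) := by
  obtain ⟨z, rfl⟩ := QuotientAddGroup.mk_surjective k
  have : z = ∑ v, z v • fun u => (chip (some v) u : ℤ) := by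
    ext u
    simp [chip, Pi.single_apply]
  rw [this, ← QuotientAddGroup.mk'_apply, map_sum]
  refine AddSubgroup.sum_mem _ fun v _ => ?_
  rw [map_zsmul]
  exact AddSubgroup.zsmul_mem _ (AddSubgroup.subset_closure (Set.mem_range_self v)) _

theorem addChar_ext {A : Type*} [CommRing A] {ψ χ : AddChar G.SandpileGroup A}
    (h : ∀ v : V, ψ (G.cls (chip (some v))) = χ (G.cls (chip (some v)))) : ψ = χ := by
  ext k
  refine AddSubgroup.closure_induction (p := fun k _ => ψ k = χ k) ?_ ?_ ?_ ?_
    (closure_cls_chip k)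
  · rintro _ ⟨v, rfl⟩
    exact h v
  · simp
  · intro a b _ _ ha hb
    rw [AddChar.map_add_eq_mul, AddChar.map_add_eq_mul, ha, hb]
  · intro a _ ha
    have h1 : ψ (-a) * ψ a = 1 := by rw [← AddChar.map_add_eq_mul]; simp
    have h2 : χ (-a) * χ a = 1 := by rw [← AddChar.map_add_eq_mul]; simp
    calc ψ (-a) = ψ (-a) * (χ (-a) * χ a) := by rw [h2, mul_one]
      _ = χ (-a) * (ψ (-a) * ψ a) := by rw [ha]; ring
      _ = χ (-a) := by rw [h1, mul_one]

/-- The eigenvalue of the sandpile chain that belongs to a character of the sandpile group. -/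
noncomputable def eigenvalue {A : Type*} [CommRing A] [Algebra ℝ A]
    (ψ : AddChar G.SandpileGroup A) : A :=
  algebraMap ℝ A (Fintype.card V + 1 : ℝ)⁻¹ * ∑ x : Option V, ψ (G.cls (chip x))

/-- Adding a chip to a recurrent sandpile and stabilizing. -/
noncomputable def IsGrounded.step (hG : G.IsGrounded) (η : G.Recurrent) (x : Option V) :
    G.Recurrent :=
  ⟨G.oplus η.1 (chip x), hG.isRecurrent_oplus η.2 (chip x)⟩

theorem IsGrounded.cls_step (hG : G.IsGrounded) (η : G.Recurrent) (x : Option V) :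
    G.cls (hG.step η x).1 = G.cls η.1 + G.cls (chip x) :=
  hG.cls_oplus _ _

theorem IsGrounded.sum_transition_mul (hG : G.IsGrounded) {A : Type*} [CommRing A] [Algebra ℝ A]
    (η : G.Recurrent) (f : G.Recurrent → A) :
    ∑ ζ, algebraMap ℝ A (G.transition η ζ) * f ζ = algebraMap ℝ A (Fintype.card V + 1 : ℝ)⁻¹ *
      ∑ x : Option V, f (hG.step η x) := by
  have h1 : ∀ ζ : G.Recurrent, algebraMap ℝ A (G.transition η ζ) * f ζ
      = algebraMap ℝ A (Fintype.card V + 1 : ℝ)⁻¹ *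
        ∑ x : Option V, if hG.step η x = ζ
          then f ζ else 0 := by
    intro ζ
    rw [transition, Matrix.of_apply, div_eq_inv_mul, map_mul, mul_assoc, map_natCast,
      Finset.card_filter, Nat.cast_sum, Finset.sum_mul]
    congr 1
    refine Finset.sum_congr rfl fun x _ => ?_
    have hiff : hG.step η x = ζ
        ↔ G.oplus η.1 (chip x) = ζ.1 := Subtype.ext_iff
    by_cases h : G.oplus η.1 (chip x) = ζ.1
    · rw [if_pos h, if_pos (hiff.2 h)]; simp
    · rw [if_neg h, if_neg (fun h' => h (hiff.1 h'))]; simp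
  rw [Finset.sum_congr rfl fun ζ _ => h1 ζ, ← Finset.mul_sum, Finset.sum_comm]
  simp

/-- The algebra `A` is general because the upper bound uses complex characters and the lower bound
real ones. -/
theorem IsGrounded.sum_transition_pow_mul_addChar (hG : G.IsGrounded) {A : Type*} [CommRing A]
    [Algebra ℝ A] (ψ : AddChar G.SandpileGroup A) (t : ℕ) (η : G.Recurrent) :
    ∑ ζ, algebraMap ℝ A ((G.transition ^ t) η ζ) * ψ (G.cls ζ.1)
      = eigenvalue ψ ^ t * ψ (G.cls η.1) := by
  induction t generalizing η with
  | zero => simp [Matrix.one_apply]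
  | succ t ih =>
    have h1 : ∀ ζ, algebraMap ℝ A ((G.transition ^ (t + 1)) η ζ) * ψ (G.cls ζ.1)
        = ∑ ξ, algebraMap ℝ A (G.transition η ξ) *
          (algebraMap ℝ A ((G.transition ^ t) ξ ζ) * ψ (G.cls ζ.1)) := by
      intro ζ
      rw [pow_succ', Matrix.mul_apply, map_sum, Finset.sum_mul]
      exact Finset.sum_congr rfl fun ξ _ => by rw [map_mul, mul_assoc]
    rw [Finset.sum_congr rfl fun ζ _ => h1 ζ, Finset.sum_comm]
    simp_rw [← Finset.mul_sum, ih]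
    rw [hG.sum_transition_mul]
    simp_rw [hG.cls_step, AddChar.map_add_eq_mul]
    rw [eigenvalue, pow_succ, Finset.mul_sum, Finset.mul_sum, Finset.mul_sum, Finset.sum_mul]
    exact Finset.sum_congr rfl fun x _ => by ring

theorem IsGrounded.sum_transition_pow (hG : G.IsGrounded) (t : ℕ) (η : G.Recurrent) :
    ∑ ζ, (G.transition ^ t) η ζ = 1 := by
  have h := hG.sum_transition_pow_mul_addChar (A := ℝ) 0 t η
  have h2 : eigenvalue (0 : AddChar G.SandpileGroup ℝ) = 1 := by
    have : (Fintype.card V + 1 : ℝ) ≠ 0 := by positivity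
    simp [eigenvalue, this]
  simpa [h2] using h

theorem transition_pow_nonneg (t : ℕ) (η ζ : G.Recurrent) : 0 ≤ (G.transition ^ t) η ζ := by
  induction t generalizing η ζ with
  | zero => rw [pow_zero, Matrix.one_apply]; split_ifs <;> norm_num
  | succ t ih =>
    rw [pow_succ, Matrix.mul_apply]
    refine Finset.sum_nonneg fun ξ _ => mul_nonneg (ih _ _) ?_
    rw [transition, Matrix.of_apply]
    positivity

end SinkGraph

/-! ### The upper bound for the distance to uniformity. -/

namespace SinkGraph

variable {V : Type} [Fintype V] [DecidableEq V] {G : SinkGraph V}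

open Classical in
/-- The `L²` upper bound for the distance to uniformity. -/
theorem IsGrounded.tvDist_sq_le [Fintype G.SandpileGroup] (hG : G.IsGrounded) {e : G.Recurrent}
    (he : G.cls e.1 = 0) (t : ℕ) :
    (2 * G.tvDist ((G.transition ^ t) e) G.uniform) ^ 2
      ≤ ∑ ψ : AddChar G.SandpileGroup ℂ with ψ ≠ 0, ‖eigenvalue ψ‖ ^ (2 * t) := by
  set f : G.SandpileGroup → ℝ := fun k =>
    (G.transition ^ t) e (hG.recurrentEquiv.symm k) - G.uniform (hG.recurrentEquiv.symm k)
  have hcard : Fintype.card G.Recurrent = Fintype.card G.SandpileGroup :=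
    Fintype.card_congr hG.recurrentEquiv
  have hcard0 : (Fintype.card G.SandpileGroup : ℝ) ≠ 0 := by
    exact_mod_cast Fintype.card_ne_zero
  have h1 : 2 * G.tvDist ((G.transition ^ t) e) G.uniform = ∑ k, |f k| := by
    rw [tvDist, ← mul_assoc, mul_one_div_cancel two_ne_zero, one_mul]
    exact (Equiv.sum_comp hG.recurrentEquiv.symm
      fun η => |(G.transition ^ t) e η - G.uniform η|).symm
  have h2 : ∀ ψ : AddChar G.SandpileGroup ℂ, ∑ k, (f k : ℂ) * ψ k
      = if ψ = 0 then 0 else eigenvalue ψ ^ t := by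
    intro ψ
    have h3 : ∑ k, (((G.transition ^ t) e (hG.recurrentEquiv.symm k) : ℝ) : ℂ) * ψ k
        = eigenvalue ψ ^ t := by
      have := hG.sum_transition_pow_mul_addChar ψ t e
      rw [he, AddChar.map_zero_eq_one, mul_one] at this
      rw [← this, ← Equiv.sum_comp hG.recurrentEquiv]
      simp_rw [Equiv.symm_apply_apply, hG.recurrentEquiv_apply]
      rfl
    have h4 : ∑ k, ((G.uniform (hG.recurrentEquiv.symm k) : ℝ) : ℂ) * ψ k
        = if ψ = 0 then 1 else 0 := by
      simp only [uniform, ← Finset.mul_sum, AddChar.sum_eq_ite, hcard]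
      split_ifs
      · push_cast
        rw [one_div_mul_cancel]
        exact_mod_cast hcard0
      · simp
    simp only [f, Complex.ofReal_sub, sub_mul, Finset.sum_sub_distrib, h3, h4]
    split_ifs with h
    · subst h
      have hpos : (Fintype.card V + 1 : ℂ) ≠ 0 := by exact_mod_cast Nat.succ_ne_zero (Fintype.card V)
      have : eigenvalue (0 : AddChar G.SandpileGroup ℂ) = 1 := by simp [eigenvalue, hpos]
      simp [this]
    · simp
  calc (2 * G.tvDist ((G.transition ^ t) e) G.uniform) ^ 2 = (∑ k, |f k|) ^ 2 := by rw [h1]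
    _ ≤ Fintype.card G.SandpileGroup * ∑ k, |f k| ^ 2 := sq_sum_le_card_mul_sum_sq
    _ = ∑ ψ : AddChar G.SandpileGroup ℂ, ‖∑ k, (f k : ℂ) * ψ k‖ ^ 2 := by
      rw [sum_norm_sq_sum_mul_addChar]
      simp only [sq_abs]
    _ = _ := by
      rw [Finset.sum_filter]
      refine Finset.sum_congr rfl fun ψ _ => ?_
      rw [h2]
      by_cases h : ψ = 0
      · simp [h]
      · rw [if_neg h, if_pos h, norm_pow, ← pow_mul, mul_comm]

/-- Angles of the values of a character, rotated so that the eigenvalue becomes nonnegative. -/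
theorem exists_angle [Finite G.SandpileGroup] (ψ : AddChar G.SandpileGroup ℂ) :
    ∃ (g : Option V → ℝ) (θ : ℝ),
      (∀ x, ψ (G.cls (chip x)) = Complex.exp ((2 * Real.pi * g x + θ : ℝ) * Complex.I)) ∧
      ‖eigenvalue ψ‖ ≤ 1 - 8 / (Fintype.card V + 1) * ∑ x, g x ^ 2 := by
  have hpi := Real.pi_pos
  set θ := (eigenvalue ψ).arg
  set g : Option V → ℝ := fun x =>
    (ψ (G.cls (chip x)) * Complex.exp ((-θ : ℝ) * Complex.I)).arg / (2 * Real.pi)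
  have hg1 : ∀ x, |2 * Real.pi * g x| ≤ Real.pi := fun x => by
    have : 2 * Real.pi * g x
        = (ψ (G.cls (chip x)) * Complex.exp ((-θ : ℝ) * Complex.I)).arg := by
      simp only [g]; field_simp
    rw [this]
    exact Complex.abs_arg_le_pi _
  have hg2 : ∀ x, ψ (G.cls (chip x)) * Complex.exp ((-θ : ℝ) * Complex.I)
      = Complex.exp ((2 * Real.pi * g x : ℝ) * Complex.I) := fun x => by
    have h1 : 2 * Real.pi * g x
        = (ψ (G.cls (chip x)) * Complex.exp ((-θ : ℝ) * Complex.I)).arg := by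
      simp only [g]; field_simp
    rw [h1]
    have h2 := Complex.norm_mul_exp_arg_mul_I
      (ψ (G.cls (chip x)) * Complex.exp ((-θ : ℝ) * Complex.I))
    rw [norm_mul, Complex.norm_exp_ofReal_mul_I, AddChar.norm_apply] at h2
    simpa using h2.symm
  have hN : (0 : ℝ) < Fintype.card V + 1 := by positivity
  refine ⟨g, θ, fun x => ?_, ?_⟩
  · rw [Complex.ofReal_add, add_mul, Complex.exp_add, ← hg2, mul_assoc, ← Complex.exp_add]
    simp
  · have h1 : (‖eigenvalue ψ‖ : ℂ) = ((Fintype.card V + 1 : ℝ)⁻¹ : ℝ) *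
        ∑ x, Complex.exp ((2 * Real.pi * g x : ℝ) * Complex.I) := by
      simp only [← hg2, ← Finset.sum_mul]
      rw [← mul_assoc]
      have h2 := Complex.norm_mul_exp_arg_mul_I (eigenvalue ψ)
      change _ = eigenvalue ψ * _
      rw [← h2, mul_assoc, ← Complex.exp_add]
      simp [θ]
    have h2 : ‖eigenvalue ψ‖ = (Fintype.card V + 1 : ℝ)⁻¹ * ∑ x, Real.cos (2 * Real.pi * g x) := by
      have := congrArg Complex.re h1
      rw [Complex.ofReal_re, Complex.re_ofReal_mul, Complex.re_sum] at this
      simpa only [Complex.exp_ofReal_mul_I_re] using this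
    -- This is `cos y ≤ 1 - (2/π²) y²` on `[-π, π]`; the restriction to that interval is why `g`
    -- comes from the principal argument.
    have h3 : ∀ x, Real.cos (2 * Real.pi * g x) ≤ 1 - 8 * g x ^ 2 := fun x => by
      refine (Real.cos_le_one_sub_mul_cos_sq (hg1 x)).trans_eq ?_
      field_simp
      ring
    have h4 := Finset.sum_le_sum fun x (_ : x ∈ Finset.univ) => h3 x
    rw [Finset.sum_sub_distrib, ← Finset.mul_sum] at h4
    simp only [Finset.sum_const, Finset.card_univ, Fintype.card_option, nsmul_eq_mul, mul_one,
      Nat.cast_add, Nat.cast_one] at h4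
    rw [h2, inv_mul_le_iff₀ hN]
    refine h4.trans_eq ?_
    field_simp

/-- The Laplacian of a graph with degrees at most `D` has operator norm at most `2D`: Cauchy–Schwarz
with the edge multiplicities as weights, then symmetry. The row of the sink is included to have this
symmetry, so its degree has to be bounded too. -/
theorem sum_sq_fullLaplacian_le {D : ℕ} (hD : ∀ x, ∑ w, G.mult x w ≤ D) (g : Option V → ℝ) :
    ∑ v, G.fullLaplacian g v ^ 2 ≤ 4 * D ^ 2 * ∑ x, g x ^ 2 := by
  have hD' : ∀ x, ∑ w, (G.mult x w : ℝ) ≤ D := fun x => by exact_mod_cast hD x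
  have h1 : ∀ x, (∑ w, (G.mult x w : ℝ) * (g x - g w)) ^ 2
      ≤ D * ∑ w, (G.mult x w : ℝ) * (2 * (g x ^ 2 + g w ^ 2)) := by
    intro x
    have hcs := Finset.sum_sq_le_sum_mul_sum_of_sq_le_mul Finset.univ
      (r := fun w => (G.mult x w : ℝ) * (g x - g w)) (f := fun w => (G.mult x w : ℝ))
      (g := fun w => (G.mult x w : ℝ) * (g x - g w) ^ 2) (fun _ _ => by positivity)
      (fun _ _ => by positivity) (fun _ _ => le_of_eq (by ring))
    refine hcs.trans (mul_le_mul (hD' x) (Finset.sum_le_sum fun w _ => ?_)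
      (Finset.sum_nonneg fun _ _ => by positivity) (by positivity))
    refine mul_le_mul_of_nonneg_left ?_ (by positivity)
    nlinarith [sq_nonneg (g x + g w)]
  have h2 : ∑ x, ∑ w, (G.mult x w : ℝ) * (2 * (g x ^ 2 + g w ^ 2))
      = 4 * ∑ x, (∑ w, (G.mult x w : ℝ)) * g x ^ 2 := by
    have h3 : ∑ x, ∑ w, (G.mult x w : ℝ) * g w ^ 2 = ∑ x, (∑ w, (G.mult x w : ℝ)) * g x ^ 2 := by
      rw [Finset.sum_comm]
      refine Finset.sum_congr rfl fun x _ => ?_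
      rw [Finset.sum_mul]
      exact Finset.sum_congr rfl fun w _ => by rw [G.symm]
    have h4 : ∀ x, ∑ w, (G.mult x w : ℝ) * (2 * (g x ^ 2 + g w ^ 2))
        = 2 * ((∑ w, (G.mult x w : ℝ)) * g x ^ 2) + 2 * ∑ w, (G.mult x w : ℝ) * g w ^ 2 := by
      intro x
      rw [Finset.sum_mul, Finset.mul_sum, Finset.mul_sum, ← Finset.sum_add_distrib]
      exact Finset.sum_congr rfl fun w _ => by ring
    rw [Finset.sum_congr rfl fun x _ => h4 x, Finset.sum_add_distrib, ← Finset.mul_sum,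
      ← Finset.mul_sum, h3]
    ring
  have h5 : ∑ x, (∑ w, (G.mult x w : ℝ)) * g x ^ 2 ≤ D * ∑ x, g x ^ 2 := by
    rw [Finset.mul_sum]
    exact Finset.sum_le_sum fun x _ => mul_le_mul_of_nonneg_right (hD' x) (sq_nonneg _)
  calc ∑ v, G.fullLaplacian g v ^ 2
      ≤ ∑ x, (∑ w, (G.mult x w : ℝ) * (g x - g w)) ^ 2 := by
        rw [Fintype.sum_option]
        exact le_add_of_nonneg_left (sq_nonneg _)
    _ ≤ ∑ x, (D : ℝ) * ∑ w, (G.mult x w : ℝ) * (2 * (g x ^ 2 + g w ^ 2)) :=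
        Finset.sum_le_sum fun x _ => h1 x
    _ = D * (4 * ∑ x, (∑ w, (G.mult x w : ℝ)) * g x ^ 2) := by rw [← Finset.mul_sum, h2]
    _ ≤ D * (4 * (D * ∑ x, g x ^ 2)) := by gcongr
    _ = _ := by ring

theorem map_sum_eq_prod {K A ι : Type*} [AddCommGroup K] [CommRing A] (ψ : AddChar K A)
    (s : Finset ι) (f : ι → K) : ψ (∑ i ∈ s, f i) = ∏ i ∈ s, ψ (f i) := by
  classical
  induction s using Finset.induction_on with
  | empty => simp
  | insert i s hi ih =>
    rw [Finset.sum_insert hi, Finset.prod_insert hi, AddChar.map_add_eq_mul, ih]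

/-- Applying `ψ` to the toppling relation at `v` gives `exp (2πi (Δg)(v)) = 1`; the common rotation
`θ` cancels in the differences. -/
theorem exists_int_fullLaplacian (ψ : AddChar G.SandpileGroup ℂ) {g : Option V → ℝ} {θ : ℝ}
    (h : ∀ x, ψ (G.cls (chip x)) = Complex.exp ((2 * Real.pi * g x + θ : ℝ) * Complex.I)) (v : V) :
    ∃ m : ℤ, (m : ℝ) = G.fullLaplacian g v := by
  have h1 : ∀ w, ψ (G.cls (chip (some v)) - G.cls (chip w))
      = Complex.exp (2 * Real.pi * Complex.I * (g (some v) - g w)) := by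
    intro w
    rw [AddChar.map_sub_eq_div, h, h, ← Complex.exp_sub]
    congr 1
    push_cast
    ring
  have h2 : Complex.exp (2 * Real.pi * Complex.I * (G.fullLaplacian g v : ℝ)) = 1 := by
    have h3 := congrArg ψ (G.sum_mult_smul_cls_sub v)
    rw [map_sum_eq_prod, AddChar.map_zero_eq_one] at h3
    simp_rw [AddChar.map_nsmul_eq_pow, h1, ← Complex.exp_nat_mul] at h3
    rw [← Complex.exp_sum] at h3
    rw [← h3, fullLaplacian]
    congr 1
    push_cast
    rw [Finset.mul_sum]
    exact Finset.sum_congr rfl fun w _ => by ring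
  obtain ⟨m, hm⟩ := Complex.exp_eq_one_iff.1 h2
  refine ⟨m, ?_⟩
  rw [mul_comm] at hm
  have := mul_right_cancel₀ Complex.two_pi_I_ne_zero hm
  exact_mod_cast this.symm

/-- A character is determined by the Laplacian of its angles. -/
theorem IsGrounded.addChar_eq (hG : G.IsGrounded) {ψ ψ' : AddChar G.SandpileGroup ℂ}
    {g g' : Option V → ℝ} {θ θ' : ℝ}
    (h : ∀ x, ψ (G.cls (chip x)) = Complex.exp ((2 * Real.pi * g x + θ : ℝ) * Complex.I))
    (h' : ∀ x, ψ' (G.cls (chip x)) = Complex.exp ((2 * Real.pi * g' x + θ' : ℝ) * Complex.I))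
    (heq : ∀ v, G.fullLaplacian g v = G.fullLaplacian g' v) : ψ = ψ' := by
  -- A chip at the sink has class zero, which eliminates `θ` in favour of `g none`. The angles then
  -- vanish at the sink, and the maximum principle recovers them from their Laplacian.
  have key : ∀ {ψ : AddChar G.SandpileGroup ℂ} {g : Option V → ℝ} {θ : ℝ},
      (∀ x, ψ (G.cls (chip x)) = Complex.exp ((2 * Real.pi * g x + θ : ℝ) * Complex.I)) →
      ∀ x, ψ (G.cls (chip x)) = Complex.exp ((2 * Real.pi * (g x - g none) : ℝ) * Complex.I) := by
    intro ψ g θ h x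
    have h1 := h none
    rw [cls_chip_none, AddChar.map_zero_eq_one] at h1
    rw [← div_one (ψ _), h1, h, ← Complex.exp_sub]
    congr 1
    push_cast
    ring
  refine addChar_ext fun v => ?_
  rw [key h, key h']
  have := hG.eq_zero (f := fun x => (g x - g none) - (g' x - g' none)) (by ring) (fun v => by
    rw [← sub_eq_zero.2 (heq v), ← fullLaplacian_sub]
    exact Finset.sum_congr rfl fun w _ => by simp only [Pi.sub_apply]; ring) (some v)
  rw [sub_eq_zero.1 this]

theorem IsGrounded.tvDist_le (hG : G.IsGrounded) {D : ℕ} (hD0 : 0 < D)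
    (hD : ∀ x, ∑ w, G.mult x w ≤ D) {e : G.Recurrent} (he : G.cls e.1 = 0) {t : ℕ}
    (ht : D ^ 2 * ((Fintype.card V + 1) * Real.log (20 * (Fintype.card V + 1))) ≤ 4 * t) :
    G.tvDist ((G.transition ^ t) e) G.uniform ≤ 1 / 4 := by
  classical
  let _ : Fintype G.SandpileGroup := Fintype.ofEquiv _ hG.recurrentEquiv
  set N : ℝ := Fintype.card V + 1 with hN
  have hN1 : 1 ≤ N := by rw [hN]; linarith [(Nat.cast_nonneg (Fintype.card V) : (0 : ℝ) ≤ _)]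
  have hD0' : (0 : ℝ) < D := by exact_mod_cast hD0
  -- The exponent combines `exp (-16 t/N * ∑ g²)` with `∑ ν² ≤ 4 D² ∑ g²`. The assumption on `t`
  -- gives `q ≤ 1/(20N)`, so the final sum is at most `e^(1/5) - 1 ≤ 1/4`.
  set q : ℝ := Real.exp (-(4 * t / (D ^ 2 * N))) with hq
  have hq1 : q ≤ (20 * N)⁻¹ := by
    rw [← Real.exp_log (by positivity : 0 < (20 * N)⁻¹), Real.log_inv, hq, Real.exp_le_exp,
      neg_le_neg_iff, le_div_iff₀ (by positivity)]
    linarith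
  have hq0 : 0 < q := Real.exp_pos _
  have hq2 : q ≤ 1 / 2 := hq1.trans (by
    rw [inv_eq_one_div]
    exact one_div_le_one_div_of_le two_pos (by linarith))
  choose g θ hψ hle using fun ψ : AddChar G.SandpileGroup ℂ => exists_angle ψ
  choose ν hν using fun ψ => exists_int_fullLaplacian ψ (hψ ψ)
  have hinj : Function.Injective ν := fun ψ ψ' h =>
    hG.addChar_eq (hψ ψ) (hψ ψ') fun v => by rw [← hν, ← hν, h]
  have hne : ∀ ψ, ν ψ = 0 → ψ = 0 := fun ψ h => by
    refine hG.addChar_eq (θ' := 0) (g' := 0) (hψ ψ) (by simp) fun v => ?_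
    rw [← hν, h]
    simp [fullLaplacian]
  have hbound : ∀ ψ, ‖eigenvalue ψ‖ ^ (2 * t) ≤ q ^ (∑ v, (ν ψ v).natAbs ^ 2) := by
    intro ψ
    have h1 : ‖eigenvalue ψ‖ ≤ Real.exp (-(8 / N * ∑ x, g ψ x ^ 2)) :=
      (hle ψ).trans (Real.one_sub_le_exp_neg _)
    have h2 : ((∑ v, (ν ψ v).natAbs ^ 2 : ℕ) : ℝ) ≤ 4 * D ^ 2 * ∑ x, g ψ x ^ 2 := by
      refine le_trans (le_of_eq ?_) (sum_sq_fullLaplacian_le hD (g ψ))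
      push_cast
      refine Finset.sum_congr rfl fun v _ => ?_
      rw [← hν]
      simp
    refine (pow_le_pow_left₀ (norm_nonneg _) h1 _).trans ?_
    rw [hq, ← Real.exp_nat_mul, ← Real.exp_nat_mul, Real.exp_le_exp]
    have h3 : (4 * t / (D ^ 2 * N)) * ((∑ v, (ν ψ v).natAbs ^ 2 : ℕ) : ℝ)
        ≤ (4 * t / (D ^ 2 * N)) * (4 * D ^ 2 * ∑ x, g ψ x ^ 2) :=
      mul_le_mul_of_nonneg_left h2 (by positivity)
    have h4 : (4 * t / (D ^ 2 * N)) * (4 * D ^ 2 * ∑ x, g ψ x ^ 2)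
        = 2 * t * (8 / N * ∑ x, g ψ x ^ 2) := by
      field_simp
      ring
    push_cast at h3 ⊢
    linarith
  have hsum : ∑ ψ : AddChar G.SandpileGroup ℂ with ψ ≠ 0, ‖eigenvalue ψ‖ ^ (2 * t) ≤ 1 / 4 := by
    calc _ ≤ ∑ ψ : AddChar G.SandpileGroup ℂ with ψ ≠ 0, q ^ (∑ v, (ν ψ v).natAbs ^ 2) :=
          Finset.sum_le_sum fun ψ _ => hbound ψ
      _ = ∑ n ∈ (Finset.univ.filter fun ψ : AddChar G.SandpileGroup ℂ => ψ ≠ 0).image ν,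
            q ^ (∑ v, (n v).natAbs ^ 2) := by
          rw [Finset.sum_image fun _ _ _ _ h => hinj h]
      _ ≤ (1 + 4 * q) ^ Fintype.card V - 1 := by
          refine sum_prod_pow_sq_le hq0.le hq2 _ fun h0 => ?_
          obtain ⟨ψ, hψ0, h0⟩ := Finset.mem_image.1 h0
          exact (Finset.mem_filter.1 hψ0).2 (hne ψ h0)
      _ ≤ Real.exp (1 / 5) - 1 := by
          refine sub_le_sub_right ?_ 1
          calc (1 + 4 * q) ^ Fintype.card V ≤ Real.exp (4 * q) ^ Fintype.card V :=
                pow_le_pow_left₀ (by positivity) (by linarith [Real.add_one_le_exp (4 * q)]) _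
            _ = Real.exp (Fintype.card V * (4 * q)) := (Real.exp_nat_mul _ _).symm
            _ ≤ Real.exp (1 / 5) := by
                rw [Real.exp_le_exp]
                calc (Fintype.card V : ℝ) * (4 * q) ≤ N * (4 * (20 * N)⁻¹) := by
                      gcongr
                      rw [hN]; linarith
                  _ = 1 / 5 := by field_simp; norm_num
      _ ≤ 1 / 4 := by
          have h5 := Real.one_sub_le_exp_neg (1 / 5)
          rw [Real.exp_neg] at h5
          have h6 := Real.exp_pos (1 / 5)
          have h7 := mul_le_mul_of_nonneg_right h5 h6.le
          rw [inv_mul_cancel₀ h6.ne'] at h7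
          linarith
  have h8 := (hG.tvDist_sq_le he t).trans hsum
  nlinarith

end SinkGraph

/-! ### Sign characters and the second moment lower bound. -/

namespace SinkGraph

variable {V : Type} [Fintype V] [DecidableEq V] {G : SinkGraph V}

/-- The pairing of integer vectors with a vector modulo two. -/
def parityPairing (φ : V → ZMod 2) : (V → ℤ) →+ ZMod 2 where
  toFun z := ∑ v, φ v * z v
  map_zero' := by simp
  map_add' a b := by simp [mul_add, Finset.sum_add_distrib]

theorem parityPairing_laplacian {φ : V → ZMod 2}
    (hφ : ∀ v, G.fullLaplacian (extendZero φ) v = 0) (z : V → ℤ) (hz : z ∈ G.toppleLattice) :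
    parityPairing φ z = 0 := by
  obtain ⟨u, rfl⟩ := hz
  change ∑ v, φ v * ((∑ w, G.laplacian v w * u w : ℤ) : ZMod 2) = 0
  have : ∀ w, ∑ v, (G.laplacian w v : ZMod 2) * φ v = 0 := fun w => by
    rw [sum_laplacian_mul, hφ]
  push_cast
  simp_rw [Finset.mul_sum]
  rw [Finset.sum_comm]
  refine Finset.sum_eq_zero fun w _ => ?_
  rw [← zero_mul (u w : ZMod 2), ← this w, Finset.sum_mul]
  exact Finset.sum_congr rfl fun v _ => by rw [G.laplacian_symm]; ring

/-- The sign character of the sandpile group that belongs to a harmonic function modulo two. -/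
noncomputable def signChar (φ : V → ZMod 2) (hφ : ∀ v, G.fullLaplacian (extendZero φ) v = 0) :
    AddChar G.SandpileGroup ℝ :=
  (AddChar.zmodChar 2 (ζ := (-1 : ℝ)) (by norm_num)).compAddMonoidHom
    (QuotientAddGroup.lift G.toppleLattice (parityPairing φ) (parityPairing_laplacian hφ))

theorem signChar_mk (φ : V → ZMod 2) (hφ : ∀ v, G.fullLaplacian (extendZero φ) v = 0)
    (z : V → ℤ) : signChar φ hφ (QuotientAddGroup.mk z)
      = AddChar.zmodChar 2 (ζ := (-1 : ℝ)) (by norm_num) (parityPairing φ z) := rfl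

theorem signChar_chip (φ : V → ZMod 2) (hφ : ∀ v, G.fullLaplacian (extendZero φ) v = 0) (v : V) :
    signChar φ hφ (G.cls (chip (some v))) = 1 - 2 * if φ v ≠ 0 then 1 else 0 := by
  have h1 : parityPairing φ (fun w => (chip (some v) w : ℤ)) = φ v := by
    simp [parityPairing, chip, Pi.single_apply]
  rw [cls, signChar_mk, h1, AddChar.zmodChar_apply]
  have h2 : ∀ a : ZMod 2, a = 0 ∨ a = 1 := by decide
  rcases h2 (φ v) with h | h
  · simp [h]
  · rw [h, if_pos one_ne_zero, ZMod.val_one]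
    norm_num

theorem eigenvalue_signChar (φ : V → ZMod 2) (hφ : ∀ v, G.fullLaplacian (extendZero φ) v = 0) :
    eigenvalue (signChar φ hφ)
      = 1 - 2 * (Finset.univ.filter fun v => φ v ≠ 0).card / (Fintype.card V + 1) := by
  have hN : (Fintype.card V + 1 : ℝ) ≠ 0 := by positivity
  rw [eigenvalue, Fintype.sum_option, cls_chip_none, AddChar.map_zero_eq_one]
  simp_rw [signChar_chip]
  rw [Finset.sum_sub_distrib, ← Finset.mul_sum, Finset.sum_boole, Algebra.algebraMap_self,
    RingHom.id_apply]
  simp only [Finset.sum_const, Finset.card_univ, nsmul_eq_mul, mul_one]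
  field_simp
  ring

theorem signChar_mul (φ φ' : V → ZMod 2) (hφ : ∀ v, G.fullLaplacian (extendZero φ) v = 0)
    (hφ' : ∀ v, G.fullLaplacian (extendZero φ') v = 0)
    (h : ∀ v, G.fullLaplacian (extendZero (φ + φ')) v = 0) (k : G.SandpileGroup) :
    signChar φ hφ k * signChar φ' hφ' k = signChar (φ + φ') h k := by
  obtain ⟨z, rfl⟩ := QuotientAddGroup.mk_surjective k
  rw [signChar_mk, signChar_mk, signChar_mk, ← AddChar.map_add_eq_mul]
  congr 1
  simp [parityPairing, add_mul, Finset.sum_add_distrib]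

theorem signChar_mul_self (φ : V → ZMod 2) (hφ : ∀ v, G.fullLaplacian (extendZero φ) v = 0)
    (k : G.SandpileGroup) : signChar φ hφ k * signChar φ hφ k = 1 := by
  obtain ⟨z, rfl⟩ := QuotientAddGroup.mk_surjective k
  rw [signChar_mk, ← AddChar.map_add_eq_mul, CharTwo.add_self_eq_zero, AddChar.map_zero_eq_one]

theorem fullLaplacian_extendZero_add {R : Type*} [CommRing R] (φ φ' : V → R) (v : V) :
    G.fullLaplacian (extendZero (φ + φ')) v
      = G.fullLaplacian (extendZero φ) v + G.fullLaplacian (extendZero φ') v := by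
  simp only [← sum_laplacian_mul, Pi.add_apply, mul_add, Finset.sum_add_distrib]

theorem IsGrounded.sum_uniform_mul_addChar (hG : G.IsGrounded) {ψ : AddChar G.SandpileGroup ℝ}
    (hψ : ψ ≠ 0) : ∑ η, G.uniform η * ψ (G.cls η.1) = 0 := by
  let _ : Fintype G.SandpileGroup := Fintype.ofEquiv _ hG.recurrentEquiv
  simp only [uniform, ← Finset.mul_sum]
  rw [mul_eq_zero]
  right
  have := Equiv.sum_comp hG.recurrentEquiv fun k => ψ k
  rw [AddChar.sum_eq_zero_iff_ne_zero.2 hψ] at this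
  exact this

theorem sum_uniform (e : G.Recurrent) : ∑ η, G.uniform η = 1 := by
  have : (Fintype.card G.Recurrent : ℝ) ≠ 0 := by
    have : Nonempty G.Recurrent := ⟨e⟩
    exact_mod_cast Fintype.card_ne_zero
  simp [uniform, this]

/-- The second moment lower bound for the distance to uniformity, from disjointly supported
harmonic functions modulo two. -/
theorem IsGrounded.card_mul_pow_le (hG : G.IsGrounded) {J : Type*} [Fintype J]
    {φ : J → V → ZMod 2} (hφ : ∀ j v, G.fullLaplacian (extendZero (φ j)) v = 0)
    (hdisj : ∀ j k, j ≠ k → ∀ v, φ j v = 0 ∨ φ k v = 0)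
    (hcard : ∀ j, (Finset.univ.filter fun v => φ j v ≠ 0).card = 3)
    (hV : 11 ≤ Fintype.card V) {e : G.Recurrent} (he : G.cls e.1 = 0) {t : ℕ}
    (htv : G.tvDist ((G.transition ^ t) e) G.uniform ≤ 1 / 4) :
    (Fintype.card J : ℝ) * (1 - 6 / (Fintype.card V + 1 : ℝ)) ^ (2 * t) ≤ 2 := by
  classical
  have hN : (12 : ℝ) ≤ Fintype.card V + 1 := by exact_mod_cast Nat.succ_le_succ hV
  set N : ℝ := Fintype.card V + 1
  set M : ℝ := (Fintype.card J : ℝ)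
  set l : ℝ := 1 - 6 / N with hl
  have hl0 : 0 ≤ l := by
    rw [hl, sub_nonneg, div_le_one (by linarith)]
    linarith
  set p := (G.transition ^ t) e
  set u := G.uniform
  have hp0 : ∀ η, 0 ≤ p η := transition_pow_nonneg t e
  have hu0 : ∀ η, 0 ≤ u η := fun η => by simp only [u, uniform]; positivity
  have hEp : ∀ ψ : AddChar G.SandpileGroup ℝ, ∑ η, p η * ψ (G.cls η.1) = eigenvalue ψ ^ t := by
    intro ψ
    have := hG.sum_transition_pow_mul_addChar ψ t e
    rwa [he, AddChar.map_zero_eq_one, mul_one] at this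
  have hone : eigenvalue (0 : AddChar G.SandpileGroup ℝ) = 1 := by
    have : (Fintype.card V + 1 : ℝ) ≠ 0 := by positivity
    simp [eigenvalue, this]
  set χ := fun j => signChar (φ j) (hφ j)
  have hχ : ∀ j, eigenvalue (χ j) = l := fun j => by
    rw [eigenvalue_signChar, hcard]
    norm_num [hl, N]
  have hχ0 : ∀ j, χ j ≠ 0 := fun j h => by
    have := hχ j
    rw [h, hone, hl] at this
    have : 6 / N = 0 := by linarith
    have : 0 < 6 / N := by positivity
    linarith
  have hadd : ∀ j k v, G.fullLaplacian (extendZero (φ j + φ k)) v = 0 := fun j k v => by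
    rw [fullLaplacian_extendZero_add, hφ, hφ, add_zero]
  have hprod : ∀ j k, j ≠ k →
      eigenvalue (signChar (φ j + φ k) (hadd j k)) = 1 - 12 / N := fun j k hjk => by
    have hd := hdisj j k hjk
    have h6 : (Finset.univ.filter fun v => (φ j + φ k) v ≠ 0).card = 6 := by
      have : (Finset.univ.filter fun v => (φ j + φ k) v ≠ 0)
          = (Finset.univ.filter fun v => φ j v ≠ 0) ∪ Finset.univ.filter fun v => φ k v ≠ 0 := by
        ext v
        rcases hd v with h | h <;> simp [h]
      rw [this, Finset.card_union_of_disjoint, hcard, hcard]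
      rw [Finset.disjoint_filter]
      intro v _ h1 h2
      rcases hd v with h | h <;> contradiction
    rw [eigenvalue_signChar, h6]
    norm_num [N]
  -- Negative correlation: the product of two distinct sign characters belongs to a support of size
  -- six, and its eigenvalue is at most the product of the two eigenvalues. Hence `f` has variance
  -- at most `M` under the chain.
  have hl2 : 1 - 12 / N ≤ l ^ 2 := by
    have : l ^ 2 = 1 - 12 / N + 36 / N ^ 2 := by rw [hl]; ring_nf
    have : 0 ≤ 36 / N ^ 2 := by positivity
    linarith
  have hl20 : 0 ≤ 1 - 12 / N := by
    rw [sub_nonneg, div_le_one (by linarith)]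
    linarith
  set f : G.Recurrent → ℝ := fun η => ∑ j, χ j (G.cls η.1)
  have hf2 : ∀ η, f η ^ 2 = ∑ j, ∑ k, χ j (G.cls η.1) * χ k (G.cls η.1) := fun η => by
    rw [sq, Finset.sum_mul_sum]
  have hswap : ∀ p : G.Recurrent → ℝ, ∑ η, p η * f η ^ 2
      = ∑ j, ∑ k, ∑ η, p η * (χ j (G.cls η.1) * χ k (G.cls η.1)) := fun p => by
    simp_rw [hf2, Finset.mul_sum]
    rw [Finset.sum_comm]
    exact Finset.sum_congr rfl fun j _ => Finset.sum_comm
  have hEpf : ∑ η, p η * f η = M * l ^ t := by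
    simp_rw [f, Finset.mul_sum]
    rw [Finset.sum_comm]
    simp_rw [hEp, hχ]
    simp [M]
  have hEuf : ∑ η, u η * f η = 0 := by
    simp_rw [f, Finset.mul_sum]
    rw [Finset.sum_comm]
    exact Finset.sum_eq_zero fun j _ => hG.sum_uniform_mul_addChar (hχ0 j)
  have hEpf2 : ∑ η, p η * f η ^ 2 ≤ M + M ^ 2 * l ^ (2 * t) := by
    rw [hswap]
    have : ∀ j k, ∑ η, p η * (χ j (G.cls η.1) * χ k (G.cls η.1))
        ≤ (if j = k then 1 else 0) + l ^ (2 * t) := fun j k => by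
      split_ifs with h
      · subst h
        simp only [χ, signChar_mul_self, mul_one]
        rw [hG.sum_transition_pow]
        have : 0 ≤ l ^ (2 * t) := by positivity
        linarith
      · simp only [χ, signChar_mul _ _ (hφ j) (hφ k) (hadd j k)]
        rw [hEp, hprod j k h, zero_add, pow_mul]
        exact pow_le_pow_left₀ hl20 hl2 t
    refine (Finset.sum_le_sum fun j _ => Finset.sum_le_sum fun k _ => this j k).trans_eq ?_
    simp only [Finset.sum_add_distrib, Finset.sum_ite_eq, Finset.mem_univ, if_true,
      Finset.sum_const, Finset.card_univ, nsmul_eq_mul, mul_one]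
    ring
  have hEuf2 : ∑ η, u η * f η ^ 2 = M := by
    rw [hswap]
    have : ∀ j k, ∑ η, u η * (χ j (G.cls η.1) * χ k (G.cls η.1))
        = if j = k then 1 else 0 := fun j k => by
      split_ifs with h
      · subst h
        simp only [χ, signChar_mul_self, mul_one]
        exact sum_uniform e
      · simp only [χ, signChar_mul _ _ (hφ j) (hφ k) (hadd j k)]
        refine hG.sum_uniform_mul_addChar fun h0 => ?_
        have h1 := hprod j k h
        rw [h0, hone] at h1
        have : 12 / N = 0 := by linarith
        have : 0 < 12 / N := by positivity
        linarith
    simp only [this, Finset.sum_ite_eq, Finset.mem_univ, if_true]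
    simp [M]
  -- Cauchy–Schwarz with weights `|p - u|`: the first factor is twice the total variation distance,
  -- the second is bounded by the two second moments of `f`.
  have hcs : (∑ η, (p η - u η) * f η) ^ 2
      ≤ (∑ η, |p η - u η|) * ∑ η, |p η - u η| * f η ^ 2 := by
    refine Finset.sum_sq_le_sum_mul_sum_of_sq_le_mul Finset.univ (fun _ _ => abs_nonneg _)
      (fun _ _ => by positivity) fun η _ => le_of_eq ?_
    rw [← mul_assoc, ← sq, sq_abs, mul_pow]
  have habs : ∑ η, |p η - u η| * f η ^ 2 ≤ 2 * M + M ^ 2 * l ^ (2 * t) := by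
    have : ∑ η, |p η - u η| * f η ^ 2 ≤ ∑ η, (p η + u η) * f η ^ 2 :=
      Finset.sum_le_sum fun η _ => mul_le_mul_of_nonneg_right
        (abs_le.2 ⟨by linarith [hp0 η, hu0 η], by linarith [hp0 η, hu0 η]⟩) (sq_nonneg _)
    simp only [add_mul, Finset.sum_add_distrib] at this
    linarith
  have hhalf : ∑ η, |p η - u η| ≤ 1 / 2 := by
    have : G.tvDist p u = 1 / 2 * ∑ η, |p η - u η| := rfl
    linarith
  simp only [sub_mul, Finset.sum_sub_distrib] at hcs
  rw [hEpf, hEuf, sub_zero, mul_pow, ← pow_mul, mul_comm t] at hcs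
  have hM0 : 0 ≤ M := Nat.cast_nonneg _
  have hfin : M ^ 2 * l ^ (2 * t) ≤ 1 / 2 * (2 * M + M ^ 2 * l ^ (2 * t)) :=
    hcs.trans (mul_le_mul hhalf habs (Finset.sum_nonneg fun _ _ => by positivity) (by norm_num))
  rcases hM0.eq_or_lt with h | h
  · rw [← h]; norm_num
  · have : M * (M * l ^ (2 * t)) ≤ M * 2 := by linarith
    exact le_of_mul_le_mul_left this h

end SinkGraph

/-! ### Decomposition of the gasket into level-one copies. -/

/-- The lower left corners of the copies of the level-one gasket graph in level `n + 1`. -/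
def gasketOffsets : ℕ → Finset (ℕ × ℕ)
  | 0 => {0}
  | n + 1 => Finset.univ.biUnion fun i : Fin 3 =>
      (gasketOffsets n).image fun x => 2 ^ (n + 1) • gasketCorner i + x

/-- The three inner vertices of the level-one gasket graph. -/
def gasketMiddle : Finset (ℕ × ℕ) := {(1, 0), (0, 1), (1, 1)}

theorem mem_gasketVertices_succ {n : ℕ} {x : ℕ × ℕ} : x ∈ gasketVertices (n + 1) ↔
    ∃ i : Fin 3, ∃ y ∈ gasketVertices n, 2 ^ n • gasketCorner i + y = x := by
  simp [gasketVertices]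

theorem mem_gasketEdges_succ {n : ℕ} {e : Sym2 (ℕ × ℕ)} : e ∈ gasketEdges (n + 1) ↔
    ∃ i : Fin 3, ∃ e' ∈ gasketEdges n, Sym2.map (fun x => 2 ^ n • gasketCorner i + x) e' = e := by
  simp [gasketEdges]

theorem mem_gasketOffsets_succ {n : ℕ} {x : ℕ × ℕ} : x ∈ gasketOffsets (n + 1) ↔
    ∃ i : Fin 3, ∃ y ∈ gasketOffsets n, 2 ^ (n + 1) • gasketCorner i + y = x := by
  simp [gasketOffsets]

theorem mem_gasketVertices_iff_offset {n : ℕ} {x : ℕ × ℕ} : x ∈ gasketVertices (n + 1) ↔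
    ∃ o ∈ gasketOffsets n, ∃ y ∈ gasketVertices 1, o + y = x := by
  induction n generalizing x with
  | zero => simp only [gasketOffsets, Finset.mem_singleton, exists_eq_left, zero_add,
      exists_eq_right]
  | succ n ih =>
    rw [mem_gasketVertices_succ]
    constructor
    · rintro ⟨i, y, hy, rfl⟩
      obtain ⟨o, ho, z, hz, rfl⟩ := ih.1 hy
      exact ⟨_, mem_gasketOffsets_succ.2 ⟨i, o, ho, rfl⟩, z, hz, add_assoc _ _ _⟩
    · rintro ⟨o, ho, z, hz, rfl⟩
      obtain ⟨i, o, h, rfl⟩ := mem_gasketOffsets_succ.1 ho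
      exact ⟨i, o + z, ih.2 ⟨o, h, z, hz, rfl⟩, (add_assoc _ _ _).symm⟩

theorem mem_gasketEdges_iff_offset {n : ℕ} {e : Sym2 (ℕ × ℕ)} : e ∈ gasketEdges (n + 1) ↔
    ∃ o ∈ gasketOffsets n, ∃ e' ∈ gasketEdges 1, Sym2.map (fun x => o + x) e' = e := by
  induction n generalizing e with
  | zero => simp [gasketOffsets]
  | succ n ih =>
    rw [mem_gasketEdges_succ]
    constructor
    · rintro ⟨i, y, hy, rfl⟩
      obtain ⟨o, ho, z, hz, rfl⟩ := ih.1 hy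
      refine ⟨_, mem_gasketOffsets_succ.2 ⟨i, o, ho, rfl⟩, z, hz, ?_⟩
      rw [Sym2.map_map]
      congr 1
      funext x
      exact add_assoc _ _ _
    · rintro ⟨o, ho, z, hz, rfl⟩
      obtain ⟨i, o, h, rfl⟩ := mem_gasketOffsets_succ.1 ho
      refine ⟨i, _, ih.2 ⟨o, h, z, hz, rfl⟩, ?_⟩
      rw [Sym2.map_map]
      congr 1
      funext x
      exact (add_assoc _ _ _).symm

theorem even_gasketOffsets {n : ℕ} {o : ℕ × ℕ} (ho : o ∈ gasketOffsets n) :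
    2 ∣ o.1 ∧ 2 ∣ o.2 := by
  induction n generalizing o with
  | zero => simp_all [gasketOffsets]
  | succ n ih =>
    obtain ⟨i, o, h, rfl⟩ := mem_gasketOffsets_succ.1 ho
    simp only [Prod.fst_add, Prod.snd_add, Prod.smul_fst, Prod.smul_snd, smul_eq_mul]
    have h2 : 2 ∣ 2 ^ (n + 1) := dvd_pow_self 2 n.succ_ne_zero
    exact ⟨dvd_add (h2.mul_right _) (ih h).1, dvd_add (h2.mul_right _) (ih h).2⟩

theorem gasketOffsets_lt {n : ℕ} {o : ℕ × ℕ} (ho : o ∈ gasketOffsets n) :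
    o.1 < 2 ^ (n + 1) ∧ o.2 < 2 ^ (n + 1) := by
  induction n generalizing o with
  | zero => simp_all [gasketOffsets]
  | succ n ih =>
    obtain ⟨i, o, h, rfl⟩ := mem_gasketOffsets_succ.1 ho
    have := ih h
    rw [pow_succ 2 (n + 1)]
    fin_cases i <;> simp [gasketCorner] <;> omega

theorem card_gasketOffsets (n : ℕ) : (gasketOffsets n).card = 3 ^ n := by
  induction n with
  | zero => rfl
  | succ n ih =>
    rw [gasketOffsets, Finset.card_biUnion]
    · simp_rw [Finset.card_image_of_injective _ (add_right_injective _), ih]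
      simp [pow_succ, mul_comm]
    · intro i _ j _ hij
      rw [Function.onFun, Finset.disjoint_left]
      intro x hx hx'
      obtain ⟨y, hy, rfl⟩ := Finset.mem_image.1 hx
      obtain ⟨z, hz, h⟩ := Finset.mem_image.1 hx'
      have h1 := gasketOffsets_lt hy
      have h2 := gasketOffsets_lt hz
      have h3 := congrArg Prod.fst h
      have h4 := congrArg Prod.snd h
      revert hij
      fin_cases i <;> fin_cases j <;> simp [gasketCorner] at h3 h4 ⊢ <;> omega

/-- Reduce modulo two: offsets vanish, the three inner vertices have distinct nonzero residues, and
the corners of a copy have residue zero. So an inner vertex lies in only one copy. -/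
theorem eq_of_add_middle_eq {o o' a y : ℕ × ℕ} (ho : 2 ∣ o.1 ∧ 2 ∣ o.2)
    (ho' : 2 ∣ o'.1 ∧ 2 ∣ o'.2) (ha : a ∈ gasketMiddle) (hy : y ∈ gasketVertices 1)
    (h : o + a = o' + y) : o = o' ∧ a = y := by
  have hy' : y ∈ ({(0, 0), (1, 0), (0, 1), (2, 0), (1, 1), (0, 2)} : Finset (ℕ × ℕ)) := by
    clear h
    revert y
    decide
  suffices hoo : o = o' from ⟨hoo, add_left_cancel (hoo ▸ h)⟩
  obtain ⟨o1, o2⟩ := o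
  obtain ⟨p1, p2⟩ := o'
  simp only [gasketMiddle, Finset.mem_insert, Finset.mem_singleton] at ha hy'
  rcases ha with rfl | rfl | rfl <;> rcases hy' with rfl | rfl | rfl | rfl | rfl | rfl <;>
    simp only [Prod.mk_add_mk, Prod.mk.injEq] at h ho ho' ⊢ <;> omega

theorem gasketMiddle_subset : gasketMiddle ⊆ gasketVertices 1 := by decide

theorem mem_gasketVertices_of_edge_one {a b : ℕ × ℕ} (h : s(a, b) ∈ gasketEdges 1) :
    a ∈ gasketVertices 1 ∧ b ∈ gasketVertices 1 := by
  have : ∀ e ∈ gasketEdges 1, e ∈ (gasketVertices 1).sym2 := by decide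
  exact Finset.mk_mem_sym2_iff.1 (this _ h)

theorem edge_at_middle {n : ℕ} {o a y : ℕ × ℕ} (ho : o ∈ gasketOffsets n) (ha : a ∈ gasketMiddle)
    (h : s(o + a, y) ∈ gasketEdges (n + 1)) : ∃ b, s(a, b) ∈ gasketEdges 1 ∧ y = o + b := by
  obtain ⟨o', ho', e, he, h⟩ := mem_gasketEdges_iff_offset.1 h
  have key : ∀ {c d : ℕ × ℕ}, s(c, d) ∈ gasketEdges 1 → o + a = o' + c → y = o' + d →
      ∃ b, s(a, b) ∈ gasketEdges 1 ∧ y = o + b := by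
    intro c d hcd h1 h2
    obtain ⟨rfl, rfl⟩ := eq_of_add_middle_eq (even_gasketOffsets ho) (even_gasketOffsets ho') ha
      (mem_gasketVertices_of_edge_one hcd).1 h1
    exact ⟨d, hcd, h2⟩
  induction e with
  | _ c d =>
    rw [Sym2.map_mk, Sym2.eq_iff] at h
    rcases h with ⟨h1, h2⟩ | ⟨h1, h2⟩
    · exact key he h1.symm h2.symm
    · exact key (Sym2.eq_swap ▸ he) h2.symm h1.symm

/-! ### Local harmonic functions modulo two on the gasket. -/

/-- The indicator modulo two of the inner vertices of the level-one copy at offset `o`. -/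
def middleIndicator (o x : ℕ × ℕ) : ZMod 2 := if x ∈ gasketMiddle.image (o + ·) then 1 else 0

theorem middleIndicator_add (o a : ℕ × ℕ) :
    middleIndicator o (o + a) = if a ∈ gasketMiddle then 1 else 0 := by
  simp [middleIndicator]

theorem middleIndicator_ne_zero {o x : ℕ × ℕ} :
    middleIndicator o x ≠ 0 ↔ ∃ a ∈ gasketMiddle, o + a = x := by
  rw [middleIndicator]
  split_ifs with h
  · simpa using h
  · simpa using h

theorem sum_edges_one_middle : ∀ a ∈ gasketVertices 1, ∑ b ∈ gasketVertices 1,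
    (if s(a, b) ∈ gasketEdges 1 then (1 : ZMod 2) else 0) *
      ((if a ∈ gasketMiddle then 1 else 0) - if b ∈ gasketMiddle then 1 else 0) = 0 := by
  decide

theorem edge_mul_sub_middleIndicator {n : ℕ} {o : ℕ × ℕ} (ho : o ∈ gasketOffsets n)
    (a b : ℕ × ℕ) :
    (if s(o + a, o + b) ∈ gasketEdges (n + 1) then (1 : ZMod 2) else 0) *
      (middleIndicator o (o + a) - middleIndicator o (o + b))
    = (if s(a, b) ∈ gasketEdges 1 then (1 : ZMod 2) else 0) *
      ((if a ∈ gasketMiddle then 1 else 0) - if b ∈ gasketMiddle then 1 else 0) := by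
  rw [middleIndicator_add, middleIndicator_add]
  by_cases hab : a ∈ gasketMiddle ∨ b ∈ gasketMiddle
  · have : s(o + a, o + b) ∈ gasketEdges (n + 1) ↔ s(a, b) ∈ gasketEdges 1 := by
      constructor
      · intro h
        rcases hab with hab | hab
        · obtain ⟨c, hc, h⟩ := edge_at_middle ho hab h
          rwa [add_left_cancel h]
        · rw [Sym2.eq_swap] at h
          obtain ⟨c, hc, h⟩ := edge_at_middle ho hab h
          rw [Sym2.eq_swap]
          rwa [add_left_cancel h]
      · intro h
        exact mem_gasketEdges_iff_offset.2 ⟨o, ho, _, h, rfl⟩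
    simp only [this]
  · simp only [not_or] at hab
    simp [hab.1, hab.2]

/-- Every edge at an inner vertex stays in its copy, so only edges of the copy at `o` contribute,
and the claim is the finite check at level one. -/
theorem sum_edges_middleIndicator {n : ℕ} {o : ℕ × ℕ} (ho : o ∈ gasketOffsets n) (x : ℕ × ℕ) :
    ∑ y ∈ gasketVertices (n + 1), (if s(x, y) ∈ gasketEdges (n + 1) then (1 : ZMod 2) else 0) *
      (middleIndicator o x - middleIndicator o y) = 0 := by
  have hcell : ∀ y, (if s(x, y) ∈ gasketEdges (n + 1) then (1 : ZMod 2) else 0) *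
      (middleIndicator o x - middleIndicator o y) ≠ 0 →
      (∃ a ∈ gasketVertices 1, x = o + a) ∧ ∃ b ∈ gasketVertices 1, y = o + b := by
    intro y hne
    have hE : s(x, y) ∈ gasketEdges (n + 1) := by
      by_contra h
      simp [h] at hne
    have hxy : middleIndicator o x ≠ 0 ∨ middleIndicator o y ≠ 0 := by
      by_contra! h
      simp [h.1, h.2] at hne
    rcases hxy with h | h
    · obtain ⟨a, ha, rfl⟩ := middleIndicator_ne_zero.1 h
      obtain ⟨b, hb, rfl⟩ := edge_at_middle ho ha hE
      exact ⟨⟨a, gasketMiddle_subset ha, rfl⟩, b, (mem_gasketVertices_of_edge_one hb).2, rfl⟩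
    · obtain ⟨b, hb, rfl⟩ := middleIndicator_ne_zero.1 h
      obtain ⟨a, ha, rfl⟩ := edge_at_middle ho hb (Sym2.eq_swap ▸ hE)
      exact ⟨⟨a, (mem_gasketVertices_of_edge_one ha).2, rfl⟩, b, gasketMiddle_subset hb, rfl⟩
  by_cases hx : ∃ a ∈ gasketVertices 1, x = o + a
  · obtain ⟨a, ha, rfl⟩ := hx
    have hsub : (gasketVertices 1).image (o + ·) ⊆ gasketVertices (n + 1) := by
      intro y hy
      obtain ⟨b, hb, rfl⟩ := Finset.mem_image.1 hy
      exact mem_gasketVertices_iff_offset.2 ⟨o, ho, b, hb, rfl⟩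
    rw [← Finset.sum_subset hsub fun y _ hy => by
      by_contra hne
      obtain ⟨b, hb, rfl⟩ := (hcell y hne).2
      exact hy (Finset.mem_image_of_mem _ hb),
      Finset.sum_image fun _ _ _ _ h => add_left_cancel h]
    simp_rw [edge_mul_sub_middleIndicator ho]
    exact sum_edges_one_middle a ha
  · exact Finset.sum_eq_zero fun y _ => by
      by_contra hne
      exact hx (hcell y hne).1

theorem fullLaplacian_middleIndicator {n : ℕ} {o : ℕ × ℕ} (ho : o ∈ gasketOffsets n)
    (v : {x // x ∈ gasketVertices (n + 1)}) :
    (gasketGraph (n + 1)).fullLaplacian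
      (SinkGraph.extendZero fun x : {x // x ∈ gasketVertices (n + 1)} => middleIndicator o x) v
      = 0 := by
  -- Here the normal boundary conditions enter: sink edges come in pairs and vanish modulo two.
  have hsink : ((gasketMult (n + 1) (some v) none : ℕ) : ZMod 2) = 0 := by
    simp only [gasketMult]
    split_ifs
    · rfl
    · rfl
  rw [SinkGraph.fullLaplacian, Fintype.sum_option]
  change ((gasketMult (n + 1) (some v) none : ℕ) : ZMod 2) * _ + _ = 0
  rw [hsink, zero_mul, zero_add]
  refine Eq.trans ?_ ((Finset.sum_coe_sort _ _).trans (sum_edges_middleIndicator ho v.1))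
  refine Finset.sum_congr rfl fun y _ => ?_
  simp [gasketGraph, gasketMult, SinkGraph.extendZero]

theorem middleIndicator_disjoint {n : ℕ} {o o' : ℕ × ℕ} (ho : o ∈ gasketOffsets n)
    (ho' : o' ∈ gasketOffsets n) (hne : o ≠ o') (x : ℕ × ℕ) :
    middleIndicator o x = 0 ∨ middleIndicator o' x = 0 := by
  by_contra! h
  obtain ⟨a, ha, rfl⟩ := middleIndicator_ne_zero.1 h.1
  obtain ⟨b, hb, h⟩ := middleIndicator_ne_zero.1 h.2
  exact hne (eq_of_add_middle_eq (even_gasketOffsets ho) (even_gasketOffsets ho') ha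
    (gasketMiddle_subset hb) h.symm).1

theorem card_middleIndicator {n : ℕ} {o : ℕ × ℕ} (ho : o ∈ gasketOffsets n) :
    ((Finset.univ : Finset {x // x ∈ gasketVertices (n + 1)}).filter fun v =>
      middleIndicator o v.1 ≠ 0).card = 3 := by
  have : ((Finset.univ : Finset {x // x ∈ gasketVertices (n + 1)}).filter fun v =>
      middleIndicator o v.1 ≠ 0).image Subtype.val = gasketMiddle.image (o + ·) := by
    ext x
    simp only [Finset.mem_image, Finset.mem_filter, Finset.mem_univ, true_and,
      middleIndicator_ne_zero, Subtype.exists, exists_and_right, exists_eq_right]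
    constructor
    · exact fun h => h.2
    · rintro ⟨a, ha, rfl⟩
      exact ⟨mem_gasketVertices_iff_offset.2 ⟨o, ho, a, gasketMiddle_subset ha, rfl⟩, a, ha, rfl⟩
  rw [← Finset.card_image_of_injective _ Subtype.val_injective, this,
    Finset.card_image_of_injective _ (add_right_injective o)]
  rfl

/-! ### Vertex count, connection to the sink and degree bound. -/

theorem card_gasketVertices_le (n : ℕ) : (gasketVertices n).card ≤ 3 ^ (n + 1) := by
  induction n with
  | zero => decide
  | succ n ih =>
    rw [gasketVertices]
    refine Finset.card_biUnion_le.trans ?_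
    refine (Finset.sum_le_card_nsmul _ _ (3 ^ (n + 1)) fun i _ =>
      Finset.card_image_le.trans ih).trans_eq ?_
    simp [pow_succ, mul_comm]

theorem le_card_gasketVertices (n : ℕ) : 3 ^ (n + 1) ≤ (gasketVertices (n + 1)).card := by
  have hsub : (gasketOffsets n).biUnion (fun o => gasketMiddle.image (o + ·))
      ⊆ gasketVertices (n + 1) := by
    intro x hx
    obtain ⟨o, ho, hx⟩ := Finset.mem_biUnion.1 hx
    obtain ⟨a, ha, rfl⟩ := Finset.mem_image.1 hx
    exact mem_gasketVertices_iff_offset.2 ⟨o, ho, a, gasketMiddle_subset ha, rfl⟩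
  refine le_trans (le_of_eq ?_) (Finset.card_le_card hsub)
  rw [Finset.card_biUnion]
  · simp_rw [Finset.card_image_of_injective _ (add_right_injective _)]
    rw [Finset.sum_const, card_gasketOffsets]
    rfl
  · intro o ho o' ho' hne
    rw [Function.onFun, Finset.disjoint_left]
    intro x hx hx'
    obtain ⟨a, ha, rfl⟩ := Finset.mem_image.1 hx
    obtain ⟨b, hb, h⟩ := Finset.mem_image.1 hx'
    exact hne (eq_of_add_middle_eq (even_gasketOffsets ho) (even_gasketOffsets ho') ha
      (gasketMiddle_subset hb) h.symm).1

theorem corner_mem_gasketVertices (n : ℕ) (i : Fin 3) :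
    2 ^ n • gasketCorner i ∈ gasketVertices n := by
  induction n with
  | zero => fin_cases i <;> decide
  | succ n ih =>
    exact mem_gasketVertices_succ.2 ⟨i, _, ih, by rw [← two_nsmul, smul_smul, pow_succ']⟩

theorem exists_edge_decreasing {n : ℕ} {x : ℕ × ℕ} (hx : x ∈ gasketVertices n) (h0 : x ≠ 0) :
    ∃ y ∈ gasketVertices n, s(x, y) ∈ gasketEdges n ∧ y.1 + y.2 < x.1 + x.2 := by
  induction n generalizing x with
  | zero =>
    refine ⟨0, by decide, ?_⟩
    revert x
    decide
  | succ n ih =>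
    have step : ∀ (i : Fin 3) {z : ℕ × ℕ}, z ∈ gasketVertices n → z ≠ 0 →
        ∃ y ∈ gasketVertices (n + 1), s(2 ^ n • gasketCorner i + z, y) ∈ gasketEdges (n + 1) ∧
          y.1 + y.2 < (2 ^ n • gasketCorner i + z).1 + (2 ^ n • gasketCorner i + z).2 := by
      intro i z hz hz0
      obtain ⟨y, hy, he, hlt⟩ := ih hz hz0
      refine ⟨_, mem_gasketVertices_succ.2 ⟨i, y, hy, rfl⟩,
        mem_gasketEdges_succ.2 ⟨i, _, he, rfl⟩, ?_⟩
      simp only [Prod.fst_add, Prod.snd_add]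
      omega
    obtain ⟨i, z, hz, rfl⟩ := mem_gasketVertices_succ.1 hx
    -- The lower left corner of copy `i` has no decreasing edge inside that copy. If it is not the
    -- origin, it is also a nonzero corner of copy `0`, where the induction hypothesis applies.
    by_cases hz0 : z = 0
    · subst hz0
      have := step 0 (corner_mem_gasketVertices n i) (by simpa using h0)
      have hc : 2 ^ n • gasketCorner 0 = 0 := by
        change 2 ^ n • (0 : ℕ × ℕ) = 0
        simp
      simpa [hc] using this
    · exact step i hz hz0

theorem gasketGraph_isGrounded (n : ℕ) : (gasketGraph n).IsGrounded := by
  refine ⟨fun x => x.elim 0 fun v => v.1.1 + v.1.2 + 1, fun v => ?_⟩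
  by_cases h0 : v.1 = 0
  · refine ⟨none, ?_, by simp⟩
    have : ∃ i, v.1 = 2 ^ n • gasketCorner i := ⟨0, by
      rw [h0]
      change 0 = 2 ^ n • (0 : ℕ × ℕ)
      simp⟩
    change (if _ then 2 else 0) ≠ 0
    rw [if_pos this]
    exact two_ne_zero
  · obtain ⟨y, hy, he, hlt⟩ := exists_edge_decreasing v.2 h0
    exact ⟨some ⟨y, hy⟩, by simp [gasketGraph, gasketMult, he], by simpa using hlt⟩

/-- The six neighbours of a point in the triangular lattice. -/
def latticeNeighbors (x : ℕ × ℕ) : Finset (ℕ × ℕ) :=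
  {(x.1 + 1, x.2), (x.1 - 1, x.2), (x.1, x.2 + 1), (x.1, x.2 - 1), (x.1 + 1, x.2 - 1),
    (x.1 - 1, x.2 + 1)}

theorem mem_latticeNeighbors_of_edge {n : ℕ} {x y : ℕ × ℕ} (h : s(x, y) ∈ gasketEdges n) :
    y ∈ latticeNeighbors x := by
  have key : ∀ {n : ℕ} {x y : ℕ × ℕ}, s(x, y) ∈ gasketEdges n →
      (x.1 + 1 = y.1 ∧ x.2 = y.2) ∨ (y.1 + 1 = x.1 ∧ x.2 = y.2) ∨
      (x.1 = y.1 ∧ x.2 + 1 = y.2) ∨ (x.1 = y.1 ∧ y.2 + 1 = x.2) ∨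
      (x.1 + 1 = y.1 ∧ y.2 + 1 = x.2) ∨ (y.1 + 1 = x.1 ∧ x.2 + 1 = y.2) := by
    intro n
    induction n with
    | zero =>
      intro x y h
      simp only [gasketEdges, Finset.mem_insert, Finset.mem_singleton, Sym2.eq_iff, gasketCorner,
        Matrix.cons_val_zero, Matrix.cons_val_one, Matrix.cons_val] at h
      rcases h with (⟨rfl, rfl⟩ | ⟨rfl, rfl⟩) | (⟨rfl, rfl⟩ | ⟨rfl, rfl⟩) |
        ⟨rfl, rfl⟩ | ⟨rfl, rfl⟩ <;> simp
    | succ n ih =>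
      intro x y h
      obtain ⟨i, e, he, h⟩ := mem_gasketEdges_succ.1 h
      induction e with
      | _ c d =>
        rw [Sym2.map_mk, Sym2.eq_iff] at h
        rcases h with ⟨rfl, rfl⟩ | ⟨rfl, rfl⟩ <;> have := ih he <;>
          simp only [Prod.fst_add, Prod.snd_add] <;> omega
  simp only [latticeNeighbors, Finset.mem_insert, Finset.mem_singleton, Prod.ext_iff]
  have := key h
  omega

/-- A crude bound, enough for the order of magnitude: at most six lattice neighbours and two sink
edges at a vertex, and six edges at the sink. -/
theorem sum_gasketMult_le (n : ℕ) (x : Option {x // x ∈ gasketVertices n}) :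
    ∑ w, (gasketGraph n).mult x w ≤ 8 := by
  rcases x with _ | v
  · rw [Fintype.sum_option]
    change 0 + ∑ v : {x // x ∈ gasketVertices n},
      (if ∃ i, v.1 = 2 ^ n • gasketCorner i then 2 else 0) ≤ 8
    rw [zero_add, ← Finset.sum_filter, Finset.sum_const, smul_eq_mul,
      ← Finset.card_image_of_injective _ Subtype.val_injective]
    have : (Finset.univ.filter fun v : {x // x ∈ gasketVertices n} =>
        ∃ i, v.1 = 2 ^ n • gasketCorner i).image Subtype.val
        ⊆ Finset.univ.image fun i => 2 ^ n • gasketCorner i := by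
      intro x hx
      obtain ⟨v, hv, rfl⟩ := Finset.mem_image.1 hx
      obtain ⟨i, hi⟩ := (Finset.mem_filter.1 hv).2
      exact Finset.mem_image.2 ⟨i, Finset.mem_univ _, hi.symm⟩
    have h3 := (Finset.card_le_card this).trans Finset.card_image_le
    simp only [Finset.card_univ, Fintype.card_fin] at h3
    omega
  · rw [Fintype.sum_option]
    have h1 : (gasketGraph n).mult (some v) none ≤ 2 := by
      simp only [gasketGraph, gasketMult]
      split_ifs <;> omega
    have h2 : ∑ w : {x // x ∈ gasketVertices n}, (gasketGraph n).mult (some v) (some w) ≤ 6 := by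
      change ∑ w : {x // x ∈ gasketVertices n}, (if s(v.1, w.1) ∈ gasketEdges n then 1 else 0) ≤ 6
      rw [← Finset.card_filter, ← Finset.card_image_of_injective _ Subtype.val_injective]
      refine le_trans (Finset.card_le_card ?_) (Finset.card_le_six : (latticeNeighbors v.1).card ≤ 6)
      intro x hx
      obtain ⟨w, hw, rfl⟩ := Finset.mem_image.1 hx
      exact mem_latticeNeighbors_of_edge (Finset.mem_filter.1 hw).2
    omega

theorem gasketVertices_subset_succ (n : ℕ) : gasketVertices n ⊆ gasketVertices (n + 1) := by
  intro x hx
  refine mem_gasketVertices_succ.2 ⟨0, x, hx, ?_⟩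
  change 2 ^ n • (0 : ℕ × ℕ) + x = x
  simp

theorem eleven_le_card_gasketVertices {n : ℕ} (hn : 2 ≤ n) : 11 ≤ (gasketVertices n).card := by
  have h : gasketVertices 2 ⊆ gasketVertices n :=
    monotone_nat_of_le_succ gasketVertices_subset_succ hn
  refine le_trans ?_ (Finset.card_le_card h)
  decide

/-! ### Mixing time of the gasket: numerical estimates and conclusion. -/

theorem three_pow_mul_pow_le {n : ℕ} (hn : 2 ≤ n) {e : (gasketGraph n).Recurrent}
    (he : (gasketGraph n).cls e.1 = 0) {t : ℕ}
    (ht : (gasketGraph n).tvDist (((gasketGraph n).transition ^ t) e) (gasketGraph n).uniform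
      ≤ 1 / 4) :
    (3 : ℝ) ^ n * (1 - 6 / ((gasketVertices n).card + 1 : ℝ)) ^ (2 * t) ≤ 6 := by
  obtain ⟨m, rfl⟩ : ∃ m, n = m + 1 := ⟨n - 1, by omega⟩
  have h := (gasketGraph_isGrounded (m + 1)).card_mul_pow_le
    (φ := fun (o : {o // o ∈ gasketOffsets m}) (x : {x // x ∈ gasketVertices (m + 1)}) =>
      middleIndicator o.1 x.1)
    (fun o v => fullLaplacian_middleIndicator o.2 v)
    (fun o o' hne v => middleIndicator_disjoint o.2 o'.2 (fun h => hne (Subtype.ext h)) v)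
    (fun o => card_middleIndicator o.2)
    (by rw [Fintype.card_coe]; exact eleven_le_card_gasketVertices hn) he ht
  rw [Fintype.card_coe, Fintype.card_coe, card_gasketOffsets] at h
  push_cast at h
  rw [pow_succ]
  linarith

/-- Bernoulli's inequality. This linear bound absorbs the error `-2v` of the logarithmic one, which
is vacuous for small `v`. -/
theorem div_thirtysix_le_of_mul_pow_le {v M : ℝ} {T : ℕ} (hv : 11 ≤ v) (hM : 9 ≤ M)
    (h : M * (1 - 6 / (v + 1)) ^ (2 * T) ≤ 6) : v / 36 ≤ T := by
  have hb : 1 + ((2 * T : ℕ) : ℝ) * (-(6 / (v + 1))) ≤ (1 + -(6 / (v + 1))) ^ (2 * T) := by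
    refine one_add_mul_le_pow ?_ _
    have : 6 / (v + 1) ≤ 1 := by
      rw [div_le_one (by linarith)]
      linarith
    linarith
  rw [← sub_eq_add_neg] at hb
  have h0 : 0 ≤ 1 - 6 / (v + 1) := by
    rw [sub_nonneg, div_le_one (by linarith)]
    linarith
  have h1 : 9 * (1 - 6 / (v + 1)) ^ (2 * T) ≤ 6 :=
    (mul_le_mul_of_nonneg_right hM (pow_nonneg h0 _)).trans h
  push_cast at hb
  have h2 : 1 / 3 ≤ 12 * T / (v + 1) := by
    have : 2 * (T : ℝ) * -(6 / (v + 1)) = -(12 * T / (v + 1)) := by ring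
    linarith
  rw [le_div_iff₀ (by linarith)] at h2
  linarith

theorem mul_log_sub_le_of_mul_pow_le {v M : ℝ} {T : ℕ} (hv : 11 ≤ v) (hM : v ≤ 3 * M)
    (h : M * (1 - 6 / (v + 1)) ^ (2 * T) ≤ 6) : v / 12 * Real.log v - 2 * v ≤ T := by
  have hM0 : 0 < M := by linarith
  have h0 : 0 < 1 - 6 / (v + 1) := by
    rw [sub_pos, div_lt_one (by linarith)]
    linarith
  have h1 := Real.log_le_log (by positivity) h
  rw [Real.log_mul hM0.ne' (by positivity), Real.log_pow] at h1
  have h2 : -Real.log (1 - 6 / (v + 1)) ≤ 6 / (v - 5) := by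
    rw [← Real.log_inv]
    refine (Real.log_le_sub_one_of_pos (by positivity)).trans_eq ?_
    have h5 : v - 5 ≠ 0 := by linarith
    have h6 : v + 1 ≠ 0 := by linarith
    have : 1 - 6 / (v + 1) = (v - 5) / (v + 1) := by field_simp; ring
    rw [this, inv_div]
    field_simp
    ring
  have h3 : Real.log v ≤ Real.log 3 + Real.log M := by
    rw [← Real.log_mul (by norm_num) hM0.ne']
    exact Real.log_le_log (by linarith) hM
  have h4 : Real.log 3 + Real.log 6 ≤ 17 := by
    rw [← Real.log_mul (by norm_num) (by norm_num)]
    refine (Real.log_le_sub_one_of_pos (by norm_num)).trans ?_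
    norm_num
  have h5 : 2 * (T : ℝ) * -Real.log (1 - 6 / (v + 1)) ≤ 2 * T * (6 / (v - 5)) :=
    mul_le_mul_of_nonneg_left h2 (by positivity)
  push_cast at h1
  have h6 : Real.log v - 17 ≤ 12 * T / (v - 5) := by
    have : 2 * (T : ℝ) * (6 / (v - 5)) = 12 * T / (v - 5) := by ring
    linarith
  rw [le_div_iff₀ (by linarith)] at h6
  have h7 := Real.log_le_sub_one_of_pos (show 0 < v by linarith)
  linarith

theorem theorem3p4 :
    ∃ c C c₀ : ℝ, 0 < c ∧ 0 < C ∧ 0 < c₀ ∧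
      ∀ n : ℕ, 2 ≤ n →
        ∃ T : ℕ, (gasketGraph n).IsMixingTime (1 / 4) T ∧
          c * ((gasketVertices n).card * Real.log (gasketVertices n).card) ≤ T ∧
          T ≤ C * ((gasketVertices n).card * Real.log (gasketVertices n).card) ∧
          c * (n * 3 ^ n) ≤ T ∧
          T ≤ C * (n * 3 ^ n) ∧
          ((gasketVertices n).card : ℝ) / 12 * Real.log (gasketVertices n).card
            - c₀ * (gasketVertices n).card ≤ T := by
  -- From `v/12 * log v - 2v ≤ T` and `v ≤ 36T` one gets `v log v ≤ (12 + 24 * 36) T = 876 T`. The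
  -- upper constant is `97 * 12`, from `T ≤ 97 v log v` and `v log v ≤ 12 n 3^n`.
  refine ⟨1 / 876, 1164, 2, by norm_num, by norm_num, by norm_num, fun n hn => ?_⟩
  have hG := gasketGraph_isGrounded n
  obtain ⟨e, hid, he⟩ := hG.exists_isIdentity
  have hcard : Fintype.card {x // x ∈ gasketVertices n} = (gasketVertices n).card :=
    Fintype.card_coe _
  have hv : (11 : ℝ) ≤ (gasketVertices n).card := by
    exact_mod_cast eleven_le_card_gasketVertices hn
  have hlow : (3 : ℝ) ^ n ≤ (gasketVertices n).card := by
    obtain ⟨m, rfl⟩ : ∃ m, n = m + 1 := ⟨n - 1, by omega⟩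
    exact_mod_cast le_card_gasketVertices m
  have hupp : ((gasketVertices n).card : ℝ) ≤ 3 * 3 ^ n := by
    have := card_gasketVertices_le n
    rw [pow_succ'] at this
    exact_mod_cast this
  set v : ℝ := ((gasketVertices n).card : ℝ) with hvdef
  have hn2 : (2 : ℝ) ≤ n := by exact_mod_cast hn
  have h9 : (9 : ℝ) ≤ 3 ^ n := by
    calc (9 : ℝ) = 3 ^ 2 := by norm_num
      _ ≤ 3 ^ n := pow_le_pow_right₀ (by norm_num) hn
  have hlog3 : 1 ≤ Real.log 3 := by
    rw [Real.le_log_iff_exp_le (by norm_num)]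
    linarith [Real.exp_one_lt_d9]
  have hlog3' : Real.log 3 ≤ 2 :=
    (Real.log_le_sub_one_of_pos (by norm_num)).trans (by norm_num)
  have hlogn : (n : ℝ) ≤ Real.log v := by
    have := Real.log_le_log (by positivity) hlow
    rw [Real.log_pow] at this
    nlinarith
  have hlogn' : Real.log v ≤ 4 * n := by
    have := Real.log_le_log (by linarith) hupp
    rw [← pow_succ', Real.log_pow] at this
    push_cast at this
    nlinarith
  have hnv : (n : ℝ) * 3 ^ n ≤ v * Real.log v := by
    rw [mul_comm]
    exact mul_le_mul hlow hlogn (by positivity) (by linarith)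
  have hvn : v * Real.log v ≤ 12 * (n * 3 ^ n) := by
    calc v * Real.log v ≤ (3 * 3 ^ n) * (4 * n) :=
          mul_le_mul hupp hlogn' (by linarith) (by positivity)
      _ = 12 * (n * 3 ^ n) := by ring
  -- The factor `16` is `D²/4` for the degree bound `D = 8`.
  set t₀ := ⌈16 * ((v + 1) * Real.log (20 * (v + 1)))⌉₊ with ht₀
  have hmix₀ : (gasketGraph n).tvDist (((gasketGraph n).transition ^ t₀) e)
      (gasketGraph n).uniform ≤ 1 / 4 := by
    refine hG.tvDist_le (D := 8) (by norm_num) (sum_gasketMult_le n) he ?_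
    rw [hcard, ← hvdef]
    have := Nat.le_ceil (16 * ((v + 1) * Real.log (20 * (v + 1))))
    push_cast
    linarith
  have hmix : ∃ t : ℕ, (gasketGraph n).tvDist (((gasketGraph n).transition ^ t) e)
      (gasketGraph n).uniform ≤ 1 / 4 := ⟨t₀, hmix₀⟩
  classical
  have hTt : Nat.find hmix ≤ t₀ := Nat.find_min' hmix hmix₀
  have hT := Nat.find_spec hmix
  have hpow := three_pow_mul_pow_le hn he hT
  set T := Nat.find hmix with hTdef
  rw [← hvdef] at hpow
  have hA := div_thirtysix_le_of_mul_pow_le hv h9 hpow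
  have hB := mul_log_sub_le_of_mul_pow_le hv hupp hpow
  have hlower : 1 / 876 * (v * Real.log v) ≤ T := by linarith
  have hupper : (T : ℝ) ≤ 97 * (v * Real.log v) := by
    have hpos : 0 ≤ 16 * ((v + 1) * Real.log (20 * (v + 1))) := by
      have : 0 ≤ Real.log (20 * (v + 1)) := Real.log_nonneg (by linarith)
      have : 0 ≤ v + 1 := by linarith
      positivity
    have h1 : (T : ℝ) ≤ 16 * ((v + 1) * Real.log (20 * (v + 1))) + 1 :=
      le_trans (by exact_mod_cast hTt) (Nat.ceil_lt_add_one hpos).le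
    have h2 : Real.log (20 * (v + 1)) ≤ 3 * Real.log v := by
      have h3 : 20 * (v + 1) ≤ v ^ 3 := by
        have : 121 ≤ v ^ 2 := by nlinarith
        have : v ^ 3 = v * v ^ 2 := by ring
        nlinarith
      have := Real.log_le_log (by linarith) h3
      rw [Real.log_pow] at this
      exact_mod_cast this
    have h4 : (v + 1) * Real.log (20 * (v + 1)) ≤ (2 * v) * (3 * Real.log v) :=
      mul_le_mul (by linarith) h2 (Real.log_nonneg (by linarith)) (by linarith)
    have h5 : 1 ≤ v * Real.log v := by nlinarith
    linarith
  refine ⟨T, ⟨e, hid, hT, fun t ht => Nat.find_min' hmix ht⟩, hlower, ?_, ?_, ?_, hB⟩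
  · have : 0 ≤ v * Real.log v := by nlinarith
    linarith
  · linarith
  · linarith
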